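/- Let $d\ge 1$ and let $\mathbb{B}_d$ be the set of nearest neighbour bonds $b=\{x,y\}$, $|x-y|=1$, of $\mathbb{Z}^d$. Let $J^-,J^+\in\mathbb{R}$, $\Omega=[J^-,J^+]^{\mathbb{B}_d}$ and $J=|J^-|\vee|J^+|$. For $\omega\in\Omega$, $\beta\ge 0$ and finite $\Lambda\subset\mathbb{Z}^d$ consider on $\mathcal{S}=\{-1,+1\}^{\mathbb{Z}^d}$ the Hamiltonian $$H^\omega_\Lambda(\sigma|\xi)=-\sum_{\{x,y\}\subset\Lambda,\,|x-y|=1}\omega_{x,y}\sigma_x\sigma_y-\sum_{x\in\Lambda,\,y\notin\Lambda,\,|x-y|=1}\omega_{x,y}\sigma_x\xi_y ,$$ and let $\mathcal{G}(\beta,\omega)$ be the set of Gibbs states, i.e. of the probability measures on $\mathcal{S}$ whose conditional distributions in finite sets $\Lambda$ given the spins $\xi$ outside are proportional to $e^{-\beta H_\Lambda^\omega(\cdot|\xi)}$ (DLR equations). With $\Delta_xH^\omega(\sigma)=-2\sum_{y:|x-y|=1}\omega_{x,y}\sigma_x\sigma_y$ and $\sigma^x$ the configuration $\sigma$ with the spin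 at $x$ reversed, the generator $L=L(\beta,\omega)$ of the heat bath dynamics is the closure in the complex Hilbert space $L^2(\mathcal{S},\mu)$, $\mu\in\mathcal{G}(\beta,\omega)$, of the operator $$(Lf)(\sigma)=\sum_{x\in\mathbb{Z}^d}\frac{1}{1+e^{-\beta\Delta_xH^\omega(\sigma)}}\,\bigl[f(\sigma)-f(\sigma^x)\bigr],\qquad f \text{ a function of finitely many spins.}$$ Let $\sigma^{(1)}_\beta$, the 1-particle branch, be the part $\mathrm{spec}(L)\cap\{z\in\mathbb{C}:|z-1|<\tfrac12\}$ of the spectrum of $L$. Theorem. For every $d\ge1$ and $J$ there are $\beta_d(J)>0$ and real functions $g_d^-,g_d^+$, depending only on $d$ and $J$, analytic on $[0,\beta_d(J))$ (that is, near each of its points), with $$g_d^\pm(\beta)=1\pm 2dJ\beta+o(\beta)\qquad(\beta\to0),$$ such that for all $J^\pm$ with $|J^-|\vee|J^+|=J$, all $\beta\in[0,\beta_d(J))$, every realization $\omega\in\Omega$ and every $\mu\in\mathcal{G}(\beta,\omega)$, $$\sigma^{(1)}_\beta\subseteq[g_d^-(\beta),g_d^+(\beta)].$$ Moreover $\sigma_\beta^{(1)}$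 is the first non trivial branch of the spectrum: it is not empty, every $u$ in the domain of $L$ with $Lu=0$ is $\mu$-almost everywhere constant, and $\mathrm{spec}(L)\subseteq\{0\}\cup\sigma_\beta^{(1)}\cup[\tfrac32,\infty)$. -/

import Mathlib

open MeasureTheory

namespace DisorderedIsing

noncomputable section

/-- The sites of the lattice `ℤ^d`. -/
abbrev Site (d : ℕ) : Type := Fin d → ℤ

/-- The nearest neighbour graph of `ℤ^d`: `x` and `y` are joined iff `|x - y| = 1`. -/
def lattice (d : ℕ) : SimpleGraph (Site d) where
  Adj x y := ∑ i, |x i - y i| = 1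
  symm := ⟨fun x y h => by simpa only [abs_sub_comm] using h⟩
  loopless := ⟨fun x h => by simp at h⟩

/-- The bonds of the lattice, as unordered pairs of neighbouring sites. -/
abbrev Bond (d : ℕ) : Type := (lattice d).edgeSet

open Classical in
/-- The finite set of nearest neighbours of a site. -/
def nbrs {d : ℕ} (x : Site d) : Finset (Site d) :=
  (Finset.Icc (x - 1) (x + 1)).filter fun y => (lattice d).Adj x y

theorem mem_nbrs {d : ℕ} {x y : Site d} : y ∈ nbrs x ↔ (lattice d).Adj x y := by
  classical
  simp only [nbrs, Finset.mem_filter, and_iff_right_iff_imp]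
  intro h
  have hi : ∀ i, |x i - y i| ≤ 1 := fun i => by
    have h' : ∑ i, |x i - y i| = 1 := h
    rw [← h']
    exact Finset.single_le_sum (f := fun i => |x i - y i|) (fun j _ => abs_nonneg _)
      (Finset.mem_univ i)
  rw [Finset.mem_Icc]
  constructor
  · intro i
    have := abs_le.1 (hi i)
    simp only [Pi.sub_apply, Pi.one_apply]
    linarith
  · intro i
    have := abs_le.1 (hi i)
    simp only [Pi.add_apply, Pi.one_apply]
    linarith

/-- Spin configurations on `ℤ^d`; the group `ℤˣ` is `{-1, +1}`. -/
abbrev Config (d : ℕ) : Type := Site d → ℤˣ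

/-- The numerical value `±1` of the spin at `x`. -/
def spin {d : ℕ} (σ : Config d) (x : Site d) : ℝ := ((σ x : ℤ) : ℝ)

/-- The configuration `σ^x`, with the spin at `x` reversed. -/
def flip {d : ℕ} (σ : Config d) (x : Site d) : Config d := Function.update σ x (-σ x)

/-- The realizations of the potential: one number in `[J⁻, J⁺]` for each bond. -/
abbrev Realization (d : ℕ) (Jm Jp : ℝ) : Type := Bond d → Set.Icc Jm Jp

open Classical in
/-- `ω_{x,y}` for neighbouring sites, and `0` for all other pairs. -/
def coupling {d : ℕ} {Jm Jp : ℝ} (ω : Realization d Jm Jp) (x y : Site d) : ℝ :=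
  if h : (lattice d).Adj x y then (ω ⟨s(x, y), h⟩ : ℝ) else 0

/-- The Hamiltonian in the finite set `Λ`, where `σ` restricted to `Λ` is the configuration in
`Λ` and `σ` outside `Λ` is the boundary condition. The first sum runs over ordered pairs, so that
each bond inside `Λ` contributes `-ω_b σ_b`. -/
def hamiltonian {d : ℕ} {Jm Jp : ℝ} (ω : Realization d Jm Jp) (Λ : Finset (Site d))
    (σ : Config d) : ℝ :=
  -(∑ x ∈ Λ, ∑ y ∈ nbrs x ∩ Λ, (1 / 2) * (spin σ x * coupling ω x y * spin σ y))
    - ∑ x ∈ Λ, ∑ y ∈ nbrs x \ Λ, spin σ x * coupling ω x y * spin σ y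

/-- The partition function in `Λ` with boundary condition `ξ`. -/
def partitionFn {d : ℕ} {Jm Jp : ℝ} (β : ℝ) (ω : Realization d Jm Jp) (Λ : Finset (Site d))
    (ξ : Config d) : ℝ :=
  ∑ η : Λ → ℤˣ, Real.exp (-β * hamiltonian ω Λ (Function.updateFinset ξ Λ η))

/-- The finite volume Gibbs measure in `Λ` with boundary condition `ξ`, as a measure on the
configurations of the whole lattice (equal to `ξ` outside `Λ`). -/
def finiteGibbs {d : ℕ} {Jm Jp : ℝ} (β : ℝ) (ω : Realization d Jm Jp) (Λ : Finset (Site d))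
    (ξ : Config d) : Measure (Config d) :=
  ∑ η : Λ → ℤˣ,
    ENNReal.ofReal (Real.exp (-β * hamiltonian ω Λ (Function.updateFinset ξ Λ η))
      / partitionFn β ω Λ ξ) • Measure.dirac (Function.updateFinset ξ Λ η)

/-- The Gibbs states at inverse temperature `β`: the probability measures which satisfy the
Dobrushin-Lanford-Ruelle equations for all finite `Λ`. -/
structure IsGibbs {d : ℕ} {Jm Jp : ℝ} (β : ℝ) (ω : Realization d Jm Jp)
    (μ : Measure (Config d)) : Prop where
  isProbabilityMeasure : IsProbabilityMeasure μ
  dlr : ∀ (Λ : Finset (Site d)) (A : Set (Config d)), MeasurableSet A →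
    μ A = ∫⁻ ξ, finiteGibbs β ω Λ ξ A ∂μ

/-- `Δ_x H(σ) = H(σ) - H(σ^x) = -2 ∑_{b ∋ x} ω_b σ_b`. -/
def deltaH {d : ℕ} {Jm Jp : ℝ} (ω : Realization d Jm Jp) (x : Site d) (σ : Config d) : ℝ :=
  -2 * ∑ y ∈ nbrs x, coupling ω x y * (spin σ x * spin σ y)

/-- The heat bath rates. -/
def rate {d : ℕ} {Jm Jp : ℝ} (β : ℝ) (ω : Realization d Jm Jp) (x : Site d)
    (σ : Config d) : ℝ :=
  1 / (1 + Real.exp (-β * deltaH ω x σ))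

/-- Cylinder functions: functions of finitely many spins. -/
def IsCylinder {d : ℕ} (f : Config d → ℂ) : Prop :=
  ∃ Λ : Finset (Site d), DependsOn f (Λ : Set (Site d))

/-- `(L f)(σ) = ∑_x w_x(σ) (f(σ) - f(σ^x))`. For a cylinder function `f` only finitely many
terms are nonzero. -/
def glauber {d : ℕ} {Jm Jp : ℝ} (β : ℝ) (ω : Realization d Jm Jp) (f : Config d → ℂ)
    (σ : Config d) : ℂ :=
  ∑ᶠ x : Site d, (rate β ω x σ : ℂ) * (f σ - f (flip σ x))

theorem flip_apply_of_ne {d : ℕ} (σ : Config d) {x y : Site d} (h : y ≠ x) :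
    flip σ x y = σ y := by
  simp [flip, h]

theorem glauber_eq_sum {d : ℕ} {Jm Jp : ℝ} (β : ℝ) (ω : Realization d Jm Jp)
    {f : Config d → ℂ} {Λ : Finset (Site d)} (hf : DependsOn f (Λ : Set (Site d)))
    (σ : Config d) :
    glauber β ω f σ = ∑ x ∈ Λ, (rate β ω x σ : ℂ) * (f σ - f (flip σ x)) := by
  refine finsum_eq_sum_of_support_subset _ fun x hx => ?_
  by_contra hxΛ
  refine hx ?_
  have : f σ = f (flip σ x) := hf fun y hy => by
    refine (flip_apply_of_ne σ ?_).symm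
    rintro rfl
    exact hxΛ hy
  simp [this]

theorem IsCylinder.exists_common {d : ℕ} {f g : Config d → ℂ} (hf : IsCylinder f)
    (hg : IsCylinder g) : ∃ Λ : Finset (Site d),
      DependsOn f (Λ : Set (Site d)) ∧ DependsOn g (Λ : Set (Site d)) := by
  classical
  obtain ⟨A, hA⟩ := hf
  obtain ⟨B, hB⟩ := hg
  exact ⟨A ∪ B, hA.mono (by simp), hB.mono (by simp)⟩

/-- The graph, in `L²(μ) × L²(μ)`, of the operator `L` on cylinder functions. -/
def coreGraph {d : ℕ} {Jm Jp : ℝ} (β : ℝ) (ω : Realization d Jm Jp)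
    (μ : Measure (Config d)) : Submodule ℂ (Lp ℂ 2 μ × Lp ℂ 2 μ) where
  carrier := {p | ∃ f : Config d → ℂ, IsCylinder f ∧ p.1 =ᵐ[μ] f ∧ p.2 =ᵐ[μ] glauber β ω f}
  zero_mem' := by
    refine ⟨0, ⟨∅, fun _ _ _ => rfl⟩, Lp.coeFn_zero ℂ 2 μ, ?_⟩
    have h : glauber β ω (0 : Config d → ℂ) = 0 := by
      funext σ
      simp [glauber]
    rw [h]
    exact Lp.coeFn_zero ℂ 2 μ
  add_mem' := by
    rintro p q ⟨f, hf, hp1, hp2⟩ ⟨g, hg, hq1, hq2⟩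
    obtain ⟨Λ, hfΛ, hgΛ⟩ := hf.exists_common hg
    have hfg : DependsOn (f + g) (Λ : Set (Site d)) := fun a b h => by
      simp [hfΛ h, hgΛ h]
    refine ⟨f + g, ⟨Λ, hfg⟩, (Lp.coeFn_add _ _).trans (hp1.add hq1), ?_⟩
    have h : glauber β ω (f + g) = glauber β ω f + glauber β ω g := by
      funext σ
      rw [Pi.add_apply, glauber_eq_sum β ω hfg, glauber_eq_sum β ω hfΛ, glauber_eq_sum β ω hgΛ,
        ← Finset.sum_add_distrib]
      refine Finset.sum_congr rfl fun x _ => ?_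
      simp only [Pi.add_apply]
      ring
    rw [h]
    exact (Lp.coeFn_add _ _).trans (hp2.add hq2)
  smul_mem' := by
    rintro c p ⟨f, ⟨Λ, hfΛ⟩, hp1, hp2⟩
    have hcf : DependsOn (c • f) (Λ : Set (Site d)) := fun a b h => by
      simp [hfΛ h]
    refine ⟨c • f, ⟨Λ, hcf⟩, (Lp.coeFn_smul _ _).trans (hp1.const_smul c), ?_⟩
    have h : glauber β ω (c • f) = c • glauber β ω f := by
      funext σ
      rw [Pi.smul_apply, glauber_eq_sum β ω hcf, glauber_eq_sum β ω hfΛ, Finset.smul_sum]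
      refine Finset.sum_congr rfl fun x _ => ?_
      simp only [Pi.smul_apply, smul_eq_mul]
      ring
    rw [h]
    exact (Lp.coeFn_smul _ _).trans (hp2.const_smul c)

/-- The generator of the heat bath dynamics: the closure in `L²(μ)` of the operator `L` on
cylinder functions. -/
def generator {d : ℕ} {Jm Jp : ℝ} (β : ℝ) (ω : Realization d Jm Jp)
    (μ : Measure (Config d)) : Lp ℂ 2 μ →ₗ.[ℂ] Lp ℂ 2 μ :=
  (coreGraph β ω μ).toLinearPMap.closure

/-- The resolvent set of an unbounded operator: the `z` for which `z - T` is a bijection from the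
domain of `T` onto the space, with a bounded inverse. -/
def resolventSet {H : Type*} [NormedAddCommGroup H] [NormedSpace ℂ H] (T : H →ₗ.[ℂ] H) : Set ℂ :=
  {z | ∃ R : H →L[ℂ] H, (∀ u : T.domain, R (z • (u : H) - T u) = u) ∧
    ∀ v : H, ∃ h : R v ∈ T.domain, z • R v - T ⟨R v, h⟩ = v}

/-- The spectrum of an unbounded operator. -/
def opSpectrum {H : Type*} [NormedAddCommGroup H] [NormedSpace ℂ H] (T : H →ₗ.[ℂ] H) : Set ℂ :=
  (resolventSet T)ᶜ

/-- The 1-particle branch of the spectrum of the generator: the part of the spectrum which is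
enclosed by the circle of radius `1/2` around `1`. For `β = 0` the spectrum consists of the
particle numbers `0, 1, 2, …`, and this part is `{1}`. -/
def oneParticleBranch {d : ℕ} {Jm Jp : ℝ} (β : ℝ) (ω : Realization d Jm Jp)
    (μ : Measure (Config d)) : Set ℂ :=
  opSpectrum (generator β ω μ) ∩ Metric.ball 1 (1 / 2)

end

end DisorderedIsing

/-! The products of spins `walsh A` diagonalise the dynamics at `β = 0`, with eigenvalue `A.card`.
At general `β` the generator sends `σ_A` to `|A| σ_A - ∑_{x ∈ A} tanh(h_x) σ_{A \ x}`, where `h_x`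
is the local field (`glauber_walsh`). If every `tanh(h_x)` has Walsh coefficients of `ℓ¹` norm at
most `κ`, the perturbation of `σ_A` has `ℓ¹` norm at most `|A| κ`, uniformly in `ω`. It is therefore
small relative to the number operator, and a Neumann series inverts `z - L` on `ℓ¹` whenever `n κ /
|z - n|` stays below a constant `q < 1` for all `n`. For `κ < 1/4` this covers every real `z < 3/2`
except `0` and the interval `[1 - κ, 1 + κ]`.

The passage to `L²(μ)` rests on Lax's theorem (`norm_le_of_symmetrizable`): the `ℓ¹` inverse is
symmetric for the inner product of `L²(μ)` by detailed balance, hence bounded there. Nothing about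
`μ` beyond the single-site DLR equations enters. A real resolvent point makes the spectrum real; a
single spin is an approximate eigenvector near `1`; and the range of `L` together with the constants
is dense, which determines the kernel.

The width `κ = 2dJβ + O(β²)` has the sharp first order because the linear part of `tanh(h_x)` is
already a Walsh sum, so that only the quadratic remainder is estimated crudely
(`exists_walshSum_eq_tanh`). -/

namespace DisorderedIsing

noncomputable section

open scoped InnerProductSpace lp

/-! ### Bounded operators on `ℓ¹` given by their values on the basis. -/

section EllOne

variable {ι E : Type*} [NormedAddCommGroup E] [NormedSpace ℂ E] [CompleteSpace E]

theorem ellOne_hasSum_norm (f : lp (fun _ : ι => ℂ) 1) : HasSum (fun i => ‖f i‖) ‖f‖ := by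
  simpa using lp.hasSum_norm (by simp) f

theorem summable_smul_of_bounded {v : ι → E} {C : ℝ} (hv : ∀ i, ‖v i‖ ≤ C)
    (f : lp (fun _ : ι => ℂ) 1) : Summable fun i => f i • v i := by
  refine Summable.of_norm_bounded ((ellOne_hasSum_norm f).summable.mul_right C) fun i => ?_
  rw [norm_smul]
  gcongr
  exact hv i

/-- The bounded operator on `ℓ¹` with prescribed values on the basis vectors. -/
def ellOneLift (v : ι → E) (C : ℝ) (hv : ∀ i, ‖v i‖ ≤ C) : lp (fun _ : ι => ℂ) 1 →L[ℂ] E :=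
  LinearMap.mkContinuous
    { toFun := fun f => ∑' i, f i • v i
      map_add' := fun f g => by
        rw [← (summable_smul_of_bounded hv f).tsum_add (summable_smul_of_bounded hv g)]
        exact tsum_congr fun i => by simp [add_smul]
      map_smul' := fun c f => by
        simp only [RingHom.id_apply]
        rw [← (summable_smul_of_bounded hv f).tsum_const_smul c]
        exact tsum_congr fun i => by simp [mul_smul] }
    C fun f => by
      have h := (ellOne_hasSum_norm f).mul_left C
      refine tsum_of_norm_bounded h fun i => ?_
      rw [norm_smul, mul_comm]
      gcongr
      exact hv i

open Classical in
/-- The basis vectors of `ℓ¹`. -/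
def unitVec (i : ι) : lp (fun _ : ι => ℂ) 1 := lp.single 1 i 1

theorem norm_unitVec (i : ι) : ‖unitVec i‖ = 1 := by
  simp [unitVec, lp.norm_single]

theorem ellOneLift_unitVec {v : ι → E} {C : ℝ} (hv : ∀ i, ‖v i‖ ≤ C) (i : ι) :
    ellOneLift v C hv (unitVec i) = v i := by
  classical
  change ∑' j, (unitVec i : ι → ℂ) j • v j = v i
  rw [tsum_eq_single i]
  · simp [unitVec]
  · intro j hj
    simp [unitVec, lp.single_apply, Pi.single_eq_of_ne hj]

theorem norm_ellOneLift_le {v : ι → E} {C : ℝ} (hC : 0 ≤ C) (hv : ∀ i, ‖v i‖ ≤ C) :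
    ‖ellOneLift v C hv‖ ≤ C :=
  LinearMap.mkContinuous_norm_le _ hC _

theorem ellOne_mem_of_unitVec {M : Submodule ℂ (lp (fun _ : ι => ℂ) 1)}
    (hM : IsClosed (M : Set (lp (fun _ : ι => ℂ) 1))) (h : ∀ i, unitVec i ∈ M)
    (f : lp (fun _ : ι => ℂ) 1) : f ∈ M := by
  classical
  refine hM.mem_of_tendsto (lp.hasSum_single (by simp) f) (Filter.Eventually.of_forall fun s => ?_)
  refine M.sum_mem fun i _ => ?_
  have : lp.single 1 i (f i) = f i • unitVec i := by
    rw [unitVec, ← lp.single_smul]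
    simp
  rw [this]
  exact M.smul_mem _ (h i)

end EllOne

/-! ### Lax's theorem. -/

section Symmetrizable

variable {X H : Type*} [NormedAddCommGroup X] [NormedSpace ℂ X]
  [NormedAddCommGroup H] [InnerProductSpace ℂ H]

/-- Lax's theorem on symmetrizable operators: an operator which is bounded on `X` and symmetric
for a continuous inner product is bounded for this inner product. -/
theorem norm_le_of_symmetrizable (e : X →L[ℂ] H) (R : X →L[ℂ] X)
    (h : ∀ f g, ⟪e (R f), e g⟫_ℂ = ⟪e f, e (R g)⟫_ℂ) (f : X) : ‖e (R f)‖ ≤ ‖R‖ * ‖e f‖ := by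
  set a : ℕ → ℝ := fun n => ‖e ((R ^ n) f)‖ with ha
  have hsucc : ∀ n, (R ^ (n + 1)) f = R ((R ^ n) f) := fun n => by
    rw [pow_succ']; rfl
  -- Moving one factor `R` across the inner product and applying Cauchy-Schwarz makes `a`
  -- log-convex.
  have hconv : ∀ n, a (n + 1) ^ 2 ≤ a n * a (n + 2) := fun n => by
    have h1 : ⟪e ((R ^ (n + 1)) f), e ((R ^ (n + 1)) f)⟫_ℂ
        = ⟪e ((R ^ n) f), e ((R ^ (n + 2)) f)⟫_ℂ := by
      rw [hsucc (n + 1)]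
      nth_rewrite 1 [hsucc n]
      exact h _ _
    have h2 : a (n + 1) ^ 2 = ‖⟪e ((R ^ (n + 1)) f), e ((R ^ (n + 1)) f)⟫_ℂ‖ := by
      rw [inner_self_eq_norm_sq_to_K]
      simp [ha]
    rw [h2, h1]
    exact norm_inner_le_norm _ _
  have hbound : ∀ n, a n ≤ ‖e‖ * ‖f‖ * ‖R‖ ^ n := fun n => by
    have h3 : ‖(R ^ n) f‖ ≤ ‖R‖ ^ n * ‖f‖ := by
      induction n with
      | zero => simp
      | succ n ih =>
        rw [hsucc, pow_succ']
        refine (R.le_opNorm _).trans ?_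
        rw [mul_assoc]
        gcongr
    calc a n ≤ ‖e‖ * ‖(R ^ n) f‖ := e.le_opNorm _
      _ ≤ ‖e‖ * (‖R‖ ^ n * ‖f‖) := by gcongr
      _ = _ := by ring
  have h0 : a 0 = ‖e f‖ := rfl
  have h1 : a 1 = ‖e (R f)‖ := by simp [ha]
  have hnn : ∀ n, 0 ≤ a n := fun n => norm_nonneg _
  rw [← h0, ← h1]
  by_contra! hlt
  have hpos0 : 0 < a 0 := by
    refine lt_of_le_of_ne (hnn 0) fun hz => ?_
    have := hconv 0
    rw [← hz] at this
    have h10 : a 1 = 0 := by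
      have : a 1 ^ 2 ≤ 0 := by simpa using this
      nlinarith [hnn 1]
    rw [← hz, h10] at hlt
    simp at hlt
  -- By log-convexity the ratios `a (n + 1) / a n` never drop below the first one, `r`. If `r >
  -- ‖R‖`, then `a n` outgrows the bound `hbound`.
  set r := a 1 / a 0 with hr
  have hrc : ‖R‖ < r := by rwa [hr, lt_div_iff₀ hpos0]
  have hrpos : 0 < r := (norm_nonneg R).trans_lt hrc
  have hgrow : ∀ n, 0 < a n ∧ r * a n ≤ a (n + 1) := by
    intro n
    induction n with
    | zero => exact ⟨hpos0, by rw [hr, div_mul_cancel₀ _ hpos0.ne']⟩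
    | succ n ih =>
      obtain ⟨hp, hle⟩ := ih
      have hp' : 0 < a (n + 1) := (mul_pos hrpos hp).trans_le hle
      refine ⟨hp', ?_⟩
      have h5 := hconv n
      have h6 : a n * (r * a (n + 1)) ≤ a n * a (n + 1 + 1) := by nlinarith
      exact le_of_mul_le_mul_left h6 hp
  have hlow : ∀ n, r ^ n * a 0 ≤ a n := by
    intro n
    induction n with
    | zero => simp
    | succ n ih =>
      calc r ^ (n + 1) * a 0 = r * (r ^ n * a 0) := by ring
        _ ≤ r * a n := by gcongr
        _ ≤ _ := (hgrow n).2
  have hfin : ∀ n, a 0 ≤ ‖e‖ * ‖f‖ * (‖R‖ / r) ^ n := fun n => by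
    rw [div_pow, mul_div_assoc', le_div_iff₀ (by positivity), mul_comm]
    exact (hlow n).trans (hbound n)
  have hlim : Filter.Tendsto (fun n : ℕ => ‖e‖ * ‖f‖ * (‖R‖ / r) ^ n) Filter.atTop (nhds 0) := by
    simpa using (tendsto_pow_atTop_nhds_zero_of_lt_one (by positivity)
      ((div_lt_one hrpos).2 hrc)).const_mul (‖e‖ * ‖f‖)
  exact absurd (ge_of_tendsto' hlim hfin) (not_le.2 hpos0)

end Symmetrizable

/-! ### Resolvent, spectrum and kernel of unbounded symmetric operators. -/

section SymmetricOperators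

variable {X H : Type*} [NormedAddCommGroup X] [NormedSpace ℂ X]
  [NormedAddCommGroup H] [InnerProductSpace ℂ H]

/-- Symmetry of a linear relation. -/
def IsSymmRel (G : Submodule ℂ (H × H)) : Prop :=
  ∀ p ∈ G, ∀ q ∈ G, ⟪p.1, q.2⟫_ℂ = ⟪p.2, q.1⟫_ℂ

theorem IsSymmRel.topologicalClosure {G : Submodule ℂ (H × H)} (hG : IsSymmRel G) :
    IsSymmRel G.topologicalClosure := by
  have h1 : ∀ p ∈ G, ∀ q ∈ G.topologicalClosure, ⟪p.1, q.2⟫_ℂ = ⟪p.2, q.1⟫_ℂ := by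
    intro p hp q hq
    have hc : IsClosed {q : H × H | ⟪p.1, q.2⟫_ℂ = ⟪p.2, q.1⟫_ℂ} :=
      isClosed_eq (by fun_prop) (by fun_prop)
    exact closure_minimal (fun q hq => hG p hp q hq) hc hq
  intro p hp q hq
  have hc : IsClosed {p : H × H | ⟪p.1, q.2⟫_ℂ = ⟪p.2, q.1⟫_ℂ} :=
    isClosed_eq (by fun_prop) (by fun_prop)
  exact closure_minimal (fun p hp => h1 p hp q hq) hc hp

/-- By symmetry, a value taken over `0` is orthogonal to the whole dense domain. -/
theorem IsSymmRel.eq_zero_of_mem {G : Submodule ℂ (H × H)} (hG : IsSymmRel G)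
    (hd : Dense (G.map (LinearMap.fst ℂ H H) : Set H)) {p : H × H} (hp : p ∈ G)
    (h0 : p.1 = 0) : p.2 = 0 := by
  refine hd.eq_zero_of_inner_left (𝕜 := ℂ) ?_
  rintro _ ⟨q, hq, rfl⟩
  rw [LinearMap.fst_apply, ← hG p hp q hq, h0, inner_zero_left]

/-- A densely defined symmetric linear relation is the graph of a closable operator. -/
theorem graph_closure_toLinearPMap {G : Submodule ℂ (H × H)} (hG : IsSymmRel G)
    (hd : Dense (G.map (LinearMap.fst ℂ H H) : Set H)) :
    G.toLinearPMap.closure.graph = G.topologicalClosure := by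
  have hg : G.toLinearPMap.graph = G :=
    G.toLinearPMap_graph_eq fun p hp h => hG.eq_zero_of_mem hd hp h
  have hd' : Dense (G.topologicalClosure.map (LinearMap.fst ℂ H H) : Set H) :=
    hd.mono (Submodule.map_mono G.le_topologicalClosure)
  have hcl : G.toLinearPMap.IsClosable := by
    refine ⟨G.topologicalClosure.toLinearPMap, ?_⟩
    rw [hg, Submodule.toLinearPMap_graph_eq _
      fun p hp h => hG.topologicalClosure.eq_zero_of_mem hd' hp h]
  rw [← hcl.graph_closure_eq_closure_graph, hg]

variable {T : H →ₗ.[ℂ] H}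

/-- A bounded operator on a dense Banach space which inverts `z - T` there extends to the
resolvent of the symmetric operator `T`. -/
theorem mem_resolventSet_of_symmetrizable [CompleteSpace H] (hT : IsSymmRel T.graph)
    (hcl : IsClosed (T.graph : Set (H × H))) (e : X →L[ℂ] H) (he : DenseRange e) (z : ℝ)
    (R : X →L[ℂ] X) (hR : ∀ f, (e (R f), (z : ℂ) • e (R f) - e f) ∈ T.graph) :
    (z : ℂ) ∈ resolventSet T := by
  have hsym : ∀ p ∈ T.graph, ∀ q ∈ T.graph,
      ⟪p.1, (z : ℂ) • q.1 - q.2⟫_ℂ = ⟪(z : ℂ) • p.1 - p.2, q.1⟫_ℂ := by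
    intro p hp q hq
    rw [inner_sub_right, inner_sub_left, hT p hp q hq, inner_smul_left, inner_smul_right,
      Complex.conj_ofReal]
  -- `z - T` is symmetric because `z` is real, and `R` inverts it on the range of `e`.
  have hR' : ∀ f g, ⟪e (R f), e g⟫_ℂ = ⟪e f, e (R g)⟫_ℂ := fun f g => by
    simpa using hsym _ (hR f) _ (hR g)
  have hnorm : ∀ f, ‖(e ∘L R : X →ₗ[ℂ] H) f‖ ≤ ‖R‖ * ‖(e : X →ₗ[ℂ] H) f‖ :=
    norm_le_of_symmetrizable e R hR'
  have he' : DenseRange (e : X →ₗ[ℂ] H) := he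
  set S : H →L[ℂ] H := (e ∘L R : X →ₗ[ℂ] H).extendOfNorm (e : X →ₗ[ℂ] H) with hS
  have hSe : ∀ f, S (e f) = e (R f) := fun f =>
    LinearMap.extendOfNorm_eq he' ⟨‖R‖, hnorm⟩ f
  have hgraph : ∀ v, (S v, (z : ℂ) • S v - v) ∈ T.graph := by
    intro v
    have hc : IsClosed {v | (S v, (z : ℂ) • S v - v) ∈ T.graph} :=
      hcl.preimage (f := fun v => (S v, (z : ℂ) • S v - v)) (by fun_prop)
    refine he.induction_on v hc fun f => ?_
    rw [hSe]
    exact hR f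
  refine ⟨S, fun u => ?_, fun v => ?_⟩
  · have hu : ((u : H), T u) ∈ T.graph := T.mem_graph u
    set w : H := u - S ((z : ℂ) • (u : H) - T u) with hw
    have hwg : (w, (z : ℂ) • w) ∈ T.graph := by
      have := T.graph.sub_mem hu (hgraph ((z : ℂ) • (u : H) - T u))
      convert this using 1
      ext
      · rfl
      · simp only [hw, smul_sub, Prod.snd_sub]
        abel
    -- `w` lies in the kernel of `z - T`, hence is orthogonal to its range, which contains the dense
    -- range of `e`.
    have hw0 : w = 0 := by
      refine Dense.eq_zero_of_inner_left (𝕜 := ℂ) he ?_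
      rintro _ ⟨f, rfl⟩
      have := hsym _ hwg _ (hR f)
      simpa using this
    exact (sub_eq_zero.1 hw0).symm
  · have hv := hgraph v
    rw [LinearPMap.mem_graph_iff] at hv
    obtain ⟨y, hy1, hy2⟩ := hv
    have hmem : S v ∈ T.domain := by
      have := y.2
      rwa [hy1] at this
    refine ⟨hmem, ?_⟩
    have : (⟨S v, hmem⟩ : T.domain) = y := Subtype.ext hy1.symm
    rw [this, hy2]
    simp

theorem isSelfAdjoint_resolvent [CompleteSpace H] (hT : IsSymmRel T.graph) {z : ℝ}
    {R : H →L[ℂ] H}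
    (hR : ∀ v : H, ∃ h : R v ∈ T.domain, (z : ℂ) • R v - T ⟨R v, h⟩ = v) : IsSelfAdjoint R := by
  rw [ContinuousLinearMap.isSelfAdjoint_iff_isSymmetric]
  intro v w
  obtain ⟨hv, hv'⟩ := hR v
  obtain ⟨hw, hw'⟩ := hR w
  have h := hT _ (T.mem_graph ⟨R v, hv⟩) _ (T.mem_graph ⟨R w, hw⟩)
  simp only at h
  change ⟪R v, w⟫_ℂ = ⟪v, R w⟫_ℂ
  calc ⟪R v, w⟫_ℂ = ⟪R v, (z : ℂ) • R w - T ⟨R w, hw⟩⟫_ℂ := by rw [hw']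
    _ = ⟪(z : ℂ) • R v - T ⟨R v, hv⟩, R w⟫_ℂ := by
      rw [inner_sub_right, inner_sub_left, inner_smul_left, inner_smul_right,
        Complex.conj_ofReal, h]
    _ = ⟪v, R w⟫_ℂ := by rw [hv']

/-- On the domain, `w - T = (1 + (w - z) R)(z - T)`, so the resolvent at `w` is `R (1 + (w - z)
R)⁻¹`. -/
theorem mem_resolventSet_of_isUnit {z w : ℂ} {R : H →L[ℂ] H}
    (hl : ∀ u : T.domain, R (z • (u : H) - T u) = u)
    (hr : ∀ v : H, ∃ h : R v ∈ T.domain, z • R v - T ⟨R v, h⟩ = v)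
    (hu : IsUnit (1 + (w - z) • R)) : w ∈ resolventSet T := by
  obtain ⟨U, hU⟩ := hu
  set V : H →L[ℂ] H := ((U⁻¹ : (H →L[ℂ] H)ˣ) : H →L[ℂ] H) with hV
  have hUV : ∀ v, V v + (w - z) • R (V v) = v := fun v => by
    have h : (U : H →L[ℂ] H) * V = 1 := U.mul_inv
    rw [hU] at h
    simpa using DFunLike.congr_fun h v
  have hVU : ∀ v, V (v + (w - z) • R v) = v := fun v => by
    have h : V * (U : H →L[ℂ] H) = 1 := U.inv_mul
    rw [hU] at h
    simpa using DFunLike.congr_fun h v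
  have hcomm : ∀ v, R (V v) = V (R v) := fun v => by
    have h1 := hVU (R (V v))
    rw [← h1]
    congr 1
    conv_rhs => rw [← hUV v]
    simp
  refine ⟨R ∘L V, fun u => ?_, fun v => ?_⟩
  · change R (V _) = _
    rw [hcomm]
    have h1 : w • (u : H) - T u = (z • (u : H) - T u) + (w - z) • (u : H) := by
      rw [sub_smul]; abel
    rw [h1, map_add, hl, map_smul]
    exact hVU u
  · obtain ⟨h, h'⟩ := hr (V v)
    refine ⟨h, ?_⟩
    change w • R (V v) - T ⟨R (V v), h⟩ = v
    have h2 : w • R (V v) - T ⟨R (V v), h⟩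
        = (z • R (V v) - T ⟨R (V v), h⟩) + (w - z) • R (V v) := by
      rw [sub_smul]
      abel
    rw [h2, h', hUV]

/-- By the resolvent identity (`key`) the inverse is `1 + (z - w) S`. -/
theorem isUnit_of_resolvents {z w : ℂ} {R S : H →L[ℂ] H}
    (hRl : ∀ u : T.domain, R (z • (u : H) - T u) = u)
    (hRr : ∀ v : H, ∃ h : R v ∈ T.domain, z • R v - T ⟨R v, h⟩ = v)
    (hSl : ∀ u : T.domain, S (w • (u : H) - T u) = u)
    (hSr : ∀ v : H, ∃ h : S v ∈ T.domain, w • S v - T ⟨S v, h⟩ = v) :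
    IsUnit (1 + (w - z) • R) := by
  have key : ∀ (a b : ℂ) (A B : H →L[ℂ] H), (∀ u : T.domain, A (a • (u : H) - T u) = u) →
      (∀ v : H, ∃ h : B v ∈ T.domain, b • B v - T ⟨B v, h⟩ = v) →
      A = B + (b - a) • (A * B) := by
    intro a b A B hA hB
    ext v
    obtain ⟨h, h'⟩ := hB v
    have h1 := hA ⟨B v, h⟩
    have h2 : v = (a • B v - T ⟨B v, h⟩) + (b - a) • B v := by
      conv_lhs => rw [← h']
      rw [sub_smul]
      abel
    conv_lhs => rw [h2]
    rw [map_add, h1, map_smul]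
    rfl
  have h1 := key z w R S hRl hSr
  have h2 := key w z S R hSl hRr
  refine ⟨⟨1 + (w - z) • R, 1 + (z - w) • S, ?_, ?_⟩, rfl⟩
  · rw [mul_add, mul_one, add_mul, one_mul, smul_mul_smul_comm]
    nth_rewrite 1 [h1]
    module
  · rw [mul_add, mul_one, add_mul, one_mul, smul_mul_smul_comm]
    nth_rewrite 1 [h2]
    module

/-- The spectrum of a symmetric operator with a real point in the resolvent set is real. -/
theorem opSpectrum_real [CompleteSpace H] (hT : IsSymmRel T.graph) {z : ℝ}
    (hz : (z : ℂ) ∈ resolventSet T) {w : ℂ} (hw : w ∈ opSpectrum T) : w = (w.re : ℂ) := by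
  by_contra hne
  refine hw ?_
  obtain ⟨R, hl, hr⟩ := hz
  have hsa := isSelfAdjoint_resolvent hT hr
  refine mem_resolventSet_of_isUnit hl hr ?_
  have hwz : w - z ≠ 0 := by
    intro h
    rw [sub_eq_zero] at h
    rw [h] at hne
    simp at hne
  have him : w.im ≠ 0 := fun h => hne (Complex.ext (by simp) (by simpa using h))
  -- The resolvent at the real point `z` is self-adjoint, so its spectrum is real, whereas this
  -- number is not.
  have hns : (-(w - z)⁻¹) ∉ spectrum ℂ R := by
    intro hs
    have h1 := hsa.mem_spectrum_eq_re hs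
    have h2 := congrArg Complex.im h1
    simp [Complex.inv_im, him] at h2
    exact hwz h2
  have hu : IsUnit (algebraMap ℂ (H →L[ℂ] H) (-(w - z)⁻¹) - R) := by
    simpa [spectrum.mem_iff] using hns
  have := (IsUnit.mk0 (-(w - z)) (neg_ne_zero.2 hwz)).map (algebraMap ℂ (H →L[ℂ] H)) |>.mul hu
  convert this using 1
  rw [mul_sub, ← map_mul, Algebra.algebraMap_eq_smul_one (-(w - z)), smul_mul_assoc, one_mul]
  rw [neg_mul_neg, mul_inv_cancel₀ hwz, map_one, neg_smul, sub_neg_eq_add]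

/-- A symmetric operator has spectrum near each approximate eigenvalue. -/
theorem opSpectrum_inter_ball_nonempty [CompleteSpace H] (hT : IsSymmRel T.graph) {z r : ℝ}
    (hr : 0 < r) (u : T.domain) (hu : ‖(z : ℂ) • (u : H) - T u‖ < r * ‖(u : H)‖) :
    (opSpectrum T ∩ Metric.ball (z : ℂ) r).Nonempty := by
  by_contra hemp
  have hres : ∀ w ∈ Metric.ball (z : ℂ) r, w ∈ resolventSet T := by
    intro w hw
    by_contra h
    exact hemp ⟨w, h, hw⟩
  obtain ⟨R, hl, hr'⟩ := hres z (Metric.mem_ball_self hr)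
  have hsa := isSelfAdjoint_resolvent hT hr'
  -- A spectral value `k` of `R` with `|k| > 1/r` would put `z - k⁻¹` in the ball, where `T` has a
  -- resolvent; then `k - R = k (1 - k⁻¹ R)` would be invertible. For self-adjoint `R` the norm is
  -- the spectral radius.
  have hnorm : ‖R‖ ≤ 1 / r := by
    have hsr : spectralRadius ℂ R ≤ ENNReal.ofReal (1 / r) := by
      refine iSup₂_le fun k hk => ?_
      rw [← enorm_eq_nnnorm, ← ofReal_norm]
      refine ENNReal.ofReal_le_ofReal ?_
      by_contra! hlt
      have hk0 : k ≠ 0 := by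
        rintro rfl
        rw [norm_zero] at hlt
        exact absurd hlt (not_lt.2 (by positivity))
      have hball : (z : ℂ) - k⁻¹ ∈ Metric.ball (z : ℂ) r := by
        rw [Metric.mem_ball, dist_eq_norm, sub_sub_cancel_left, norm_neg, norm_inv]
        rw [one_div] at hlt
        exact inv_lt_of_inv_lt₀ hr hlt
      obtain ⟨S, hSl, hSr⟩ := hres _ hball
      have hu := isUnit_of_resolvents hl hr' hSl hSr
      refine hk (spectrum.mem_resolventSet_iff.2 ?_)
      have h2 := ((IsUnit.mk0 k hk0).map (algebraMap ℂ (H →L[ℂ] H))).mul hu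
      convert h2 using 1
      rw [mul_add, mul_one, Algebra.algebraMap_eq_smul_one, smul_mul_assoc, one_mul, smul_smul,
        sub_sub_cancel_left, mul_neg, mul_inv_cancel₀ hk0, neg_one_smul, sub_eq_add_neg]
    rw [R.spectralRadius_eq_nnnorm hsa, ← enorm_eq_nnnorm, ← ofReal_norm] at hsr
    exact (ENNReal.ofReal_le_ofReal_iff (by positivity)).1 hsr
  have h1 : ‖(u : H)‖ ≤ 1 / r * ‖(z : ℂ) • (u : H) - T u‖ := by
    conv_lhs => rw [← hl u]
    exact (R.le_opNorm _).trans (by gcongr)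
  rw [one_div, inv_mul_eq_div, le_div_iff₀ hr] at h1
  linarith

/-- If the range of a symmetric operator together with one vector is dense, then the kernel is
spanned by this vector. -/
theorem mem_span_of_apply_eq_zero [CompleteSpace H] (hT : IsSymmRel T.graph) (v : H)
    (hv : ‖v‖ = 1) (hv0 : (v, 0) ∈ T.graph)
    (hd : ∀ w : H, (∀ p ∈ T.graph, ⟪w, p.2⟫_ℂ = 0) → ⟪w, v⟫_ℂ = 0 → w = 0)
    (u : T.domain) (hu : T u = 0) : ∃ c : ℂ, (u : H) = c • v := by
  -- The component of `u` orthogonal to `v` is in the kernel of `T`, hence also orthogonal to the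
  -- range of `T`.
  refine ⟨⟪v, (u : H)⟫_ℂ, sub_eq_zero.1 (hd _ (fun p hp => ?_) ?_)⟩
  · have h1 := hT _ (T.mem_graph u) p hp
    have h2 := hT _ hv0 p hp
    simp only [hu, inner_zero_left] at h1 h2
    rw [inner_sub_left, inner_smul_left, h1, h2]
    simp
  · rw [inner_sub_left, inner_smul_left, inner_conj_symm, inner_self_eq_norm_sq_to_K, hv]
    simp

end SymmetricOperators

/-! ### Topology of the configuration space and the neighbours of a site. -/

section Configurations

variable {d : ℕ}

instance : DiscreteMeasurableSpace ℤˣ :=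
  ⟨fun s => ⟨Units.val '' s, MeasurableSet.of_discrete, Units.val_injective.preimage_image s⟩⟩

instance : BorelSpace (Config d) := inferInstanceAs (BorelSpace (Site d → ℤˣ))

theorem continuous_of_dependsOn {E : Type*} [TopologicalSpace E] [Nonempty E] {f : Config d → E}
    {Λ : Finset (Site d)} (hf : DependsOn f (Λ : Set (Site d))) : Continuous f := by
  obtain ⟨g, rfl⟩ := (dependsOn_iff_exists_comp).1 hf
  exact (continuous_of_discreteTopology (f := g)).comp (by fun_prop)

theorem IsCylinder.continuous {f : Config d → ℂ} (hf : IsCylinder f) : Continuous f :=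
  continuous_of_dependsOn hf.choose_spec

theorem spin_eq_one_or (σ : Config d) (x : Site d) : spin σ x = 1 ∨ spin σ x = -1 := by
  rcases Int.units_eq_one_or (σ x) with h | h <;> simp [spin, h]

theorem spin_mul_self (σ : Config d) (x : Site d) : spin σ x * spin σ x = 1 := by
  rcases spin_eq_one_or σ x with h | h <;> simp [h]

theorem abs_spin (σ : Config d) (x : Site d) : |spin σ x| = 1 := by
  rcases spin_eq_one_or σ x with h | h <;> simp [h]

theorem spin_flip_self (σ : Config d) (x : Site d) : spin (flip σ x) x = -spin σ x := by
  simp [spin, flip]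

theorem flip_flip (σ : Config d) (x : Site d) : flip (flip σ x) x = σ := by
  simp [flip]

theorem dependsOn_spin (x : Site d) :
    DependsOn (fun σ : Config d => spin σ x) (({x} : Finset (Site d)) : Set (Site d)) :=
  fun σ τ h => by simp [spin, h x (by simp)]

theorem continuous_spin (x : Site d) : Continuous fun σ : Config d => spin σ x :=
  continuous_of_dependsOn (dependsOn_spin x)

theorem continuous_flip (x : Site d) : Continuous fun σ : Config d => flip σ x := by
  unfold flip
  fun_prop

theorem not_mem_nbrs_self (x : Site d) : x ∉ nbrs x := fun h =>
  (lattice d).irrefl (mem_nbrs.1 h)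

/-- Nonnegative integers with sum `1` have exactly one nonzero term, so a neighbour differs from `x`
by `±1` in one coordinate. -/
theorem card_nbrs_le (x : Site d) : (nbrs x).card ≤ 2 * d := by
  classical
  have hsub : nbrs x ⊆ (Finset.univ : Finset (Fin d × Bool)).image
      fun p => Function.update x p.1 (if p.2 then x p.1 + 1 else x p.1 - 1) := by
    intro y hy
    have h : ∑ i, |x i - y i| = 1 := mem_nbrs.1 hy
    obtain ⟨i, hi⟩ : ∃ i, x i ≠ y i := by
      by_contra! hcon
      simp [hcon] at h
    have hsum := Finset.add_sum_erase Finset.univ (fun i => |x i - y i|) (Finset.mem_univ i)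
    simp only [h] at hsum
    have hpos : 0 < |x i - y i| := abs_pos.2 (sub_ne_zero.2 hi)
    have hnn : 0 ≤ ∑ j ∈ Finset.univ.erase i, |x j - y j| :=
      Finset.sum_nonneg fun j _ => abs_nonneg _
    have h0 : ∑ j ∈ Finset.univ.erase i, |x j - y j| = 0 := by omega
    have h1 : |x i - y i| = 1 := by omega
    have hj : ∀ j, j ≠ i → y j = x j := fun j hj => by
      have := (Finset.sum_eq_zero_iff_of_nonneg fun j _ => abs_nonneg _).1 h0 j (by simp [hj])
      rw [abs_eq_zero, sub_eq_zero] at this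
      exact this.symm
    rw [Finset.mem_image]
    rcases (abs_eq zero_le_one).1 h1 with h2 | h2
    · refine ⟨(i, false), Finset.mem_univ _, funext fun j => ?_⟩
      by_cases hji : j = i
      · subst hji
        simp
        omega
      · simp [hji, hj j hji]
    · refine ⟨(i, true), Finset.mem_univ _, funext fun j => ?_⟩
      by_cases hji : j = i
      · subst hji
        simp
        omega
      · simp [hji, hj j hji]
  refine (Finset.card_le_card hsub).trans (Finset.card_image_le.trans ?_)
  simp [mul_comm]

end Configurations

/-! ### Walsh functions and absolutely summable Walsh expansions. -/

section Walsh

variable {d : ℕ}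

/-- The product `σ_A` of the spins in `A`. -/
def walsh (A : Finset (Site d)) : C(Config d, ℂ) where
  toFun σ := ∏ x ∈ A, (spin σ x : ℂ)
  continuous_toFun := continuous_finsetProd _ fun x _ =>
    Complex.continuous_ofReal.comp (continuous_spin x)

theorem walsh_apply (A : Finset (Site d)) (σ : Config d) :
    walsh A σ = ∏ x ∈ A, (spin σ x : ℂ) := rfl

theorem dependsOn_walsh (A : Finset (Site d)) :
    DependsOn (walsh A : Config d → ℂ) (A : Set (Site d)) := fun σ τ h =>
  Finset.prod_congr rfl fun x hx => by simp [spin, h x hx]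

theorem norm_walsh_apply (A : Finset (Site d)) (σ : Config d) : ‖walsh A σ‖ = 1 := by
  rw [walsh_apply, norm_prod]
  exact Finset.prod_eq_one fun x _ => by simp [abs_spin]

theorem norm_walsh_le (A : Finset (Site d)) : ‖walsh A‖ ≤ 1 :=
  (ContinuousMap.norm_le _ zero_le_one).2 fun σ => (norm_walsh_apply A σ).le

open Classical in
-- Spins at common sites cancel because they square to `1`. Multiplication by `σ_A` thus permutes
-- the Walsh basis, which makes `walshShift` a contraction.
theorem walsh_symmDiff (A B : Finset (Site d)) (σ : Config d) :
    walsh (symmDiff A B) σ = walsh A σ * walsh B σ := by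
  have hsq : ∀ C : Finset (Site d), walsh C σ * walsh C σ = 1 := fun C => by
    rw [walsh_apply, ← Finset.prod_mul_distrib]
    refine Finset.prod_eq_one fun x _ => ?_
    rw [← Complex.ofReal_mul, spin_mul_self, Complex.ofReal_one]
  have hA : walsh A σ = walsh (A \ B) σ * walsh (A ∩ B) σ := by
    simp only [walsh_apply]
    rw [mul_comm]
    exact (Finset.prod_inter_mul_prod_sdiff A B _).symm
  have hB : walsh B σ = walsh (B \ A) σ * walsh (A ∩ B) σ := by
    simp only [walsh_apply]
    rw [mul_comm, Finset.inter_comm]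
    exact (Finset.prod_inter_mul_prod_sdiff B A _).symm
  have hAB : walsh (symmDiff A B) σ = walsh (A \ B) σ * walsh (B \ A) σ := by
    simp only [walsh_apply]
    rw [symmDiff, Finset.sup_eq_union, Finset.prod_union disjoint_sdiff_sdiff]
  rw [hAB, hA, hB]
  linear_combination (-(walsh (A \ B) σ * walsh (B \ A) σ)) * hsq (A ∩ B)

open Classical in
theorem walsh_eq_mul_erase {A : Finset (Site d)} {x : Site d} (hx : x ∈ A) (σ : Config d) :
    walsh A σ = spin σ x * walsh (A.erase x) σ :=
  (Finset.mul_prod_erase A (fun y => (spin σ y : ℂ)) hx).symm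

theorem walsh_flip {A : Finset (Site d)} {x : Site d} (hx : x ∈ A) (σ : Config d) :
    walsh A (flip σ x) = -walsh A σ := by
  classical
  rw [walsh_eq_mul_erase hx, walsh_eq_mul_erase hx, spin_flip_self]
  have : walsh (A.erase x) (flip σ x) = walsh (A.erase x) σ :=
    dependsOn_walsh _ fun y hy => flip_apply_of_ne σ (Finset.ne_of_mem_erase hy)
  rw [this]
  push_cast
  ring

/-- The space of absolutely summable Walsh coefficients. -/
abbrev WalshSpace (d : ℕ) : Type := lp (fun _ : Finset (Site d) => ℂ) 1

/-- The continuous function with given Walsh coefficients. -/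
def walshSum : WalshSpace d →L[ℂ] C(Config d, ℂ) := ellOneLift walsh 1 norm_walsh_le

theorem walshSum_unitVec (A : Finset (Site d)) : walshSum (unitVec A) = walsh A :=
  ellOneLift_unitVec _ _

open Classical in
/-- Multiplication by `σ_A` on the Walsh coefficients. -/
def walshShift (A : Finset (Site d)) : WalshSpace d →L[ℂ] WalshSpace d :=
  ellOneLift (fun B => unitVec (symmDiff A B)) 1 fun _ => (norm_unitVec _).le

theorem norm_walshShift_apply_le (A : Finset (Site d)) (f : WalshSpace d) :
    ‖walshShift A f‖ ≤ ‖f‖ := by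
  simpa using (walshShift A).le_of_opNorm_le (norm_ellOneLift_le zero_le_one _) f

theorem walshSum_walshShift (A : Finset (Site d)) (f : WalshSpace d) (σ : Config d) :
    walshSum (walshShift A f) σ = walsh A σ * walshSum f σ := by
  classical
  let ev : C(Config d, ℂ) →L[ℂ] ℂ := ContinuousMap.evalCLM ℂ σ
  let D : WalshSpace d →L[ℂ] ℂ :=
    ev ∘L walshSum ∘L walshShift A - walsh A σ • (ev ∘L walshSum)
  have h : f ∈ LinearMap.ker (D : WalshSpace d →ₗ[ℂ] ℂ) := by
    refine ellOne_mem_of_unitVec D.isClosed_ker (fun B => ?_) f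
    change ev (walshSum (walshShift A (unitVec B))) - walsh A σ * ev (walshSum (unitVec B)) = 0
    rw [walshShift, ellOneLift_unitVec, walshSum_unitVec, walshSum_unitVec]
    change walsh (symmDiff A B) σ - walsh A σ * walsh B σ = 0
    rw [walsh_symmDiff, sub_self]
  exact sub_eq_zero.1 h

/-- The Walsh expansion of a function of finitely many spins. -/
theorem exists_walshSum_eq {S : Finset (Site d)} {T : Config d → ℂ} {M : ℝ}
    (hT : DependsOn T (S : Set (Site d))) (hM : ∀ σ, ‖T σ‖ ≤ M) :
    ∃ k : WalshSpace d, ‖k‖ ≤ 2 ^ S.card * M ∧ ∀ σ, walshSum k σ = T σ := by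
  classical
  induction S using Finset.induction_on generalizing T with
  | empty =>
    refine ⟨T 1 • unitVec ∅, ?_, fun σ => ?_⟩
    · simpa [norm_smul, norm_unitVec] using hM 1
    · rw [map_smul, walshSum_unitVec, ContinuousMap.smul_apply, walsh_apply]
      simpa using hT (fun i hi => by simp at hi)
  | insert x S hx ih =>
    -- Split `T = (U 1 + U (-1)) / 2 + σ_x (U 1 - U (-1)) / 2`. Both coefficients keep the bound `M`
    -- and do not depend on `σ_x`, so each site costs a factor `2`.
    set U : ℤˣ → Config d → ℂ := fun s σ => T (Function.update σ x s) with hU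
    have hUd : ∀ s, DependsOn (U s) (S : Set (Site d)) := fun s σ τ h => hT fun y hy => by
      by_cases hyx : y = x
      · subst hyx
        simp
      · simp only [Function.update_of_ne hyx]
        exact h y (by simpa [hyx] using hy)
    have h1 : ∀ σ, ‖(U 1 σ + U (-1) σ) / 2‖ ≤ M := fun σ => by
      rw [norm_div, Complex.norm_ofNat, div_le_iff₀ two_pos]
      linarith [norm_add_le (U 1 σ) (U (-1) σ), hM (Function.update σ x 1),
        hM (Function.update σ x (-1))]
    have h2 : ∀ σ, ‖(U 1 σ - U (-1) σ) / 2‖ ≤ M := fun σ => by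
      rw [norm_div, Complex.norm_ofNat, div_le_iff₀ two_pos]
      linarith [norm_sub_le (U 1 σ) (U (-1) σ), hM (Function.update σ x 1),
        hM (Function.update σ x (-1))]
    obtain ⟨k₁, hk₁, hk₁'⟩ := ih (T := fun σ => (U 1 σ + U (-1) σ) / 2)
      (fun σ τ h => by simp only [hUd 1 h, hUd (-1) h]) h1
    obtain ⟨k₂, hk₂, hk₂'⟩ := ih (T := fun σ => (U 1 σ - U (-1) σ) / 2)
      (fun σ τ h => by simp only [hUd 1 h, hUd (-1) h]) h2
    refine ⟨k₁ + walshShift {x} k₂, ?_, fun σ => ?_⟩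
    · rw [Finset.card_insert_of_notMem hx, pow_succ]
      linarith [norm_add_le k₁ (walshShift {x} k₂), norm_walshShift_apply_le {x} k₂]
    · rw [map_add, ContinuousMap.add_apply, walshSum_walshShift, hk₁', hk₂', walsh_apply,
        Finset.prod_singleton]
      have hself : U (σ x) σ = T σ := by simp [hU]
      rcases Int.units_eq_one_or (σ x) with h | h
      · rw [h] at hself
        rw [← hself]
        simp only [spin, h]
        push_cast
        ring
      · rw [h] at hself
        rw [← hself]
        simp only [spin, h]
        push_cast
        ring

/-- The cylinder functions are dense in the continuous functions. -/
theorem dense_isCylinder : Dense {f : C(Config d, ℂ) | IsCylinder (f : Config d → ℂ)} := by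
  let A : StarSubalgebra ℂ C(Config d, ℂ) :=
    { carrier := {f | IsCylinder (f : Config d → ℂ)}
      mul_mem' := fun {f g} hf hg => by
        obtain ⟨Λ, h1, h2⟩ := IsCylinder.exists_common hf hg
        exact ⟨Λ, fun σ τ h => by simp [h1 h, h2 h]⟩
      add_mem' := fun {f g} hf hg => by
        obtain ⟨Λ, h1, h2⟩ := IsCylinder.exists_common hf hg
        exact ⟨Λ, fun σ τ h => by simp [h1 h, h2 h]⟩
      algebraMap_mem' := fun c => ⟨∅, fun σ τ h => by simp⟩
      star_mem' := fun {f} hf => by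
        obtain ⟨Λ, h1⟩ := hf
        exact ⟨Λ, fun σ τ h => by simp [h1 h]⟩ }
  have hsep : A.SeparatesPoints := by
    intro σ τ hne
    obtain ⟨x, hx⟩ := Function.ne_iff.1 hne
    refine ⟨walsh {x}, ⟨walsh {x}, ⟨{x}, dependsOn_walsh _⟩, rfl⟩, fun h => hx ?_⟩
    simpa [walsh_apply, spin, Units.ext_iff] using h
  have h := ContinuousMap.starSubalgebra_topologicalClosure_eq_top_of_separatesPoints A hsep
  intro f
  have : f ∈ A.topologicalClosure := by rw [h]; trivial
  exact this

end Walsh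

/-! ### The heat bath rates, the generator on Walsh functions and the single-site Gibbs kernel. -/

section HeatBath

variable {d : ℕ} {Jm Jp : ℝ}

/-- The local field `β ∑_y ω_{x,y} σ_y` at the site `x`. -/
def localField (β : ℝ) (ω : Realization d Jm Jp) (x : Site d) (σ : Config d) : ℝ :=
  β * ∑ y ∈ nbrs x, coupling ω x y * spin σ y

variable (β : ℝ) (ω : Realization d Jm Jp)

theorem dependsOn_localField (x : Site d) :
    DependsOn (localField β ω x) (nbrs x : Set (Site d)) := fun σ τ h => by
  unfold localField
  congr 1
  exact Finset.sum_congr rfl fun y hy => by simp [spin, h y hy]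

theorem localField_flip (x : Site d) (σ : Config d) :
    localField β ω x (flip σ x) = localField β ω x σ :=
  dependsOn_localField β ω x fun y hy => flip_apply_of_ne σ <| by
    rintro rfl
    exact not_mem_nbrs_self y hy

theorem rate_eq (x : Site d) (σ : Config d) :
    rate β ω x σ = 1 / (1 + Real.exp (2 * (spin σ x * localField β ω x σ))) := by
  unfold rate deltaH localField
  congr 3
  have : ∑ y ∈ nbrs x, coupling ω x y * (spin σ x * spin σ y)
      = spin σ x * ∑ y ∈ nbrs x, coupling ω x y * spin σ y := by
    rw [Finset.mul_sum]
    exact Finset.sum_congr rfl fun y _ => by ring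
  rw [this]
  ring

theorem rate_flip (x : Site d) (σ : Config d) :
    rate β ω x (flip σ x) = 1 / (1 + Real.exp (-2 * (spin σ x * localField β ω x σ))) := by
  rw [rate_eq, spin_flip_self, localField_flip]
  congr 3
  ring

theorem rate_nonneg (x : Site d) (σ : Config d) : 0 ≤ rate β ω x σ := by
  unfold rate
  positivity

theorem continuous_localField (x : Site d) : Continuous (localField β ω x) :=
  continuous_of_dependsOn (dependsOn_localField β ω x)

theorem continuous_rate (x : Site d) : Continuous (rate β ω x) := by
  have h : rate β ω x =
      fun σ => 1 / (1 + Real.exp (2 * (spin σ x * localField β ω x σ))) :=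
    funext fun σ => rate_eq β ω x σ
  rw [h]
  refine continuous_const.div ?_ fun σ => by positivity
  have := continuous_spin x
  have := continuous_localField β ω x
  fun_prop

/-- The rate is `(1 - tanh (s h)) / 2` with `s = σ_x`, and `s tanh (s h) = tanh h` since `tanh` is
odd. What is left besides `σ_x` depends only on the neighbouring spins. -/
theorem two_mul_spin_mul_rate (x : Site d) (σ : Config d) :
    2 * (spin σ x * rate β ω x σ) = spin σ x - Real.tanh (localField β ω x σ) := by
  rw [rate_eq, Real.tanh_eq_sinh_div_cosh, Real.sinh_eq, Real.cosh_eq]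
  set h := localField β ω x σ
  have hp := Real.exp_pos h
  have hm := Real.exp_pos (-h)
  have hmul : Real.exp h * Real.exp (-h) = 1 := by rw [← Real.exp_add]; simp
  rcases spin_eq_one_or σ x with hs | hs
  · have h2 : Real.exp (2 * (1 * h)) = Real.exp h * Real.exp h := by
      rw [← Real.exp_add]; congr 1; ring
    rw [hs, h2]
    field_simp
    linear_combination (-2 * Real.exp h) * hmul
  · have h2 : Real.exp (2 * (-1 * h)) = Real.exp (-h) * Real.exp (-h) := by
      rw [← Real.exp_add]; congr 1; ring
    rw [hs, h2]
    field_simp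
    linear_combination (2 * Real.exp (-h)) * hmul

open Classical in
-- Flipping a site of `A` changes the sign of `σ_A`, so each site contributes `2 w_x σ_A`. This
-- exhibits the generator as number operator minus interaction.
theorem glauber_walsh (A : Finset (Site d)) (σ : Config d) :
    glauber β ω (walsh A) σ = A.card * walsh A σ -
      ∑ x ∈ A, (Real.tanh (localField β ω x σ) : ℂ) * walsh (A.erase x) σ := by
  rw [glauber_eq_sum β ω (dependsOn_walsh A), ← nsmul_eq_mul, ← Finset.sum_const,
    ← Finset.sum_sub_distrib]
  refine Finset.sum_congr rfl fun x hx => ?_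
  rw [walsh_flip hx, walsh_eq_mul_erase hx]
  have h := congrArg (fun r : ℝ => (r : ℂ)) (two_mul_spin_mul_rate β ω x σ)
  push_cast at h ⊢
  linear_combination walsh (A.erase x) σ * h

theorem IsCylinder.continuous_glauber {f : Config d → ℂ} (hf : IsCylinder f) :
    Continuous (glauber β ω f) := by
  obtain ⟨Λ, hΛ⟩ := id hf
  have h : glauber β ω f = fun σ => ∑ x ∈ Λ, (rate β ω x σ : ℂ) * (f σ - f (flip σ x)) :=
    funext fun σ => glauber_eq_sum β ω hΛ σ
  rw [h]
  refine continuous_finsetSum _ fun x _ => ?_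
  exact (Complex.continuous_ofReal.comp (continuous_rate β ω x)).mul
    (hf.continuous.sub (hf.continuous.comp (continuous_flip x)))

theorem hamiltonian_singleton (x : Site d) (σ : Config d) :
    -β * hamiltonian ω {x} σ = spin σ x * localField β ω x σ := by
  classical
  have h1 : nbrs x ∩ {x} = ∅ := by
    rw [Finset.inter_singleton_of_notMem (not_mem_nbrs_self x)]
  have h2 : nbrs x \ {x} = nbrs x := by
    rw [Finset.sdiff_singleton_eq_erase, Finset.erase_eq_of_notMem (not_mem_nbrs_self x)]
  unfold hamiltonian localField
  simp only [Finset.sum_singleton]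
  have h3 : ∑ y ∈ nbrs x, spin σ x * coupling ω x y * spin σ y
      = spin σ x * ∑ y ∈ nbrs x, coupling ω x y * spin σ y := by
    rw [Finset.mul_sum]
    exact Finset.sum_congr rfl fun y _ => by ring
  rw [h1, h2, h3, Finset.sum_empty]
  ring

theorem sum_singleton_units {E : Type*} [AddCommMonoid E] (x : Site d) (ξ : Config d)
    (g : Config d → E) :
    ∑ η : (({x} : Finset (Site d)) → ℤˣ), g (Function.updateFinset ξ {x} η)
      = g ξ + g (flip ξ x) := by
  have h : ∀ η : (({x} : Finset (Site d)) → ℤˣ), Function.updateFinset ξ {x} η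
      = Function.update ξ x (η ⟨x, Finset.mem_singleton_self x⟩) := by
    intro η
    ext y
    by_cases hy : y = x
    · subst hy
      simp [Function.updateFinset]
    · simp [Function.updateFinset, hy]
  simp only [h]
  have e := (Equiv.funUnique (({x} : Finset (Site d))) ℤˣ).sum_comp
    (fun s => g (Function.update ξ x s))
  have e' : ∑ η : (({x} : Finset (Site d)) → ℤˣ),
      g (Function.update ξ x (η ⟨x, Finset.mem_singleton_self x⟩))
      = ∑ s : ℤˣ, g (Function.update ξ x s) := by
    rw [← e]
    rfl
  rw [e']
  have hu : (Finset.univ : Finset ℤˣ) = {1, -1} := by decide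
  rw [hu, Finset.sum_pair (by decide)]
  have hs : g ξ = g (Function.update ξ x (ξ x)) := by simp
  unfold flip
  rw [hs]
  rcases Int.units_eq_one_or (ξ x) with h | h
  · simp [h]
  · simp [h, add_comm]

/-- The heat bath rate is the conditional probability of the flipped spin, so the Gibbs kernel of
one site can be written with rates. -/
theorem finiteGibbs_singleton_apply (x : Site d) (ξ : Config d) {A : Set (Config d)}
    (hA : MeasurableSet A) :
    finiteGibbs β ω {x} ξ A = ENNReal.ofReal (rate β ω x (flip ξ x)) * A.indicator 1 ξ
      + ENNReal.ofReal (rate β ω x ξ) * A.indicator 1 (flip ξ x) := by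
  have hZ : partitionFn β ω {x} ξ = Real.exp (spin ξ x * localField β ω x ξ)
      + Real.exp (-(spin ξ x * localField β ω x ξ)) := by
    unfold partitionFn
    rw [sum_singleton_units x ξ fun σ => Real.exp (-β * hamiltonian ω {x} σ)]
    rw [hamiltonian_singleton, hamiltonian_singleton, spin_flip_self, localField_flip, neg_mul]
  unfold finiteGibbs
  rw [sum_singleton_units x ξ fun σ =>
    ENNReal.ofReal (Real.exp (-β * hamiltonian ω {x} σ) / partitionFn β ω {x} ξ)
      • Measure.dirac σ]
  rw [hamiltonian_singleton, hamiltonian_singleton, spin_flip_self, localField_flip, neg_mul, hZ,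
    rate_flip, rate_eq]
  set t := spin ξ x * localField β ω x ξ
  have hp := Real.exp_pos t
  have hm := Real.exp_pos (-t)
  have hmul : Real.exp t * Real.exp (-t) = 1 := by rw [← Real.exp_add]; simp
  have h1 : Real.exp t / (Real.exp t + Real.exp (-t)) = 1 / (1 + Real.exp (-2 * t)) := by
    have : Real.exp (-2 * t) = Real.exp (-t) * Real.exp (-t) := by
      rw [← Real.exp_add]; congr 1; ring
    rw [this]
    field_simp
    linear_combination Real.exp (-t) * hmul
  have h2 : Real.exp (-t) / (Real.exp t + Real.exp (-t)) = 1 / (1 + Real.exp (2 * t)) := by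
    have : Real.exp (2 * t) = Real.exp t * Real.exp t := by
      rw [← Real.exp_add]; congr 1; ring
    rw [this]
    field_simp
    linear_combination Real.exp t * hmul
  rw [h1, h2]
  simp [Measure.dirac_apply' _ hA]

end HeatBath

/-! ### Reversibility of Gibbs states and the closed generator in `L²(μ)`. -/

section GibbsStates

variable {d : ℕ} {Jm Jp : ℝ} {β : ℝ} {ω : Realization d Jm Jp} {μ : Measure (Config d)}

theorem integrable_of_continuous {E : Type*} [NormedAddCommGroup E] [SecondCountableTopology E]
    [IsFiniteMeasure μ] {F : Config d → E} (hF : Continuous F) : Integrable F μ :=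
  hF.integrable_of_hasCompactSupport (HasCompactSupport.of_compactSpace F)

theorem IsGibbs.measure_eq (hμ : IsGibbs β ω μ) (x : Site d) :
    μ = μ.withDensity (fun σ => ENNReal.ofReal (rate β ω x (flip σ x)))
      + (μ.withDensity fun σ => ENNReal.ofReal (rate β ω x σ)).map (fun σ => flip σ x) := by
  have hfl : Measurable fun σ : Config d => flip σ x := (continuous_flip x).measurable
  have hr : Measurable (rate β ω x) := (continuous_rate β ω x).measurable
  ext A hA
  rw [hμ.dlr {x} A hA]
  simp_rw [finiteGibbs_singleton_apply β ω x _ hA]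
  have hpre : MeasurableSet ((fun σ : Config d => flip σ x) ⁻¹' A) := hfl hA
  rw [lintegral_add_left, Measure.add_apply, Measure.map_apply hfl hA, withDensity_apply _ hA,
    withDensity_apply _ hpre, ← lintegral_indicator hA, ← lintegral_indicator hpre]
  · congr 1
    · refine lintegral_congr fun σ => ?_
      by_cases h : σ ∈ A <;> simp [h]
    · refine lintegral_congr fun σ => ?_
      by_cases h : flip σ x ∈ A <;> simp [h]
  · exact ((hr.comp hfl).ennreal_ofReal).mul (measurable_one.indicator hA)

theorem IsGibbs.integral_eq (hμ : IsGibbs β ω μ) (x : Site d) {F : Config d → ℂ}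
    (hF : Continuous F) :
    ∫ σ, F σ ∂μ = ∫ σ, ((rate β ω x (flip σ x) : ℂ) * F σ + rate β ω x σ * F (flip σ x)) ∂μ := by
  have := hμ.isProbabilityMeasure
  have hfl : Measurable fun σ : Config d => flip σ x := (continuous_flip x).measurable
  have hc := continuous_rate β ω x
  have hcf : Continuous fun σ => rate β ω x (flip σ x) := hc.comp (continuous_flip x)
  have hFf := hF.comp (continuous_flip x)
  have i1 : Integrable (fun σ => (rate β ω x (flip σ x) : ℂ) * F σ) μ :=
    integrable_of_continuous ((Complex.continuous_ofReal.comp hcf).mul hF)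
  have i2 : Integrable (fun σ => (rate β ω x σ : ℂ) * F (flip σ x)) μ :=
    integrable_of_continuous ((Complex.continuous_ofReal.comp hc).mul hFf)
  have hwd : ∀ (r : Config d → ℝ), Continuous r → (∀ σ, 0 ≤ r σ) → ∀ G : Config d → ℂ,
      ∫ σ, G σ ∂(μ.withDensity fun σ => ENNReal.ofReal (r σ)) = ∫ σ, (r σ : ℂ) * G σ ∂μ := by
    intro r hr hr0 G
    rw [integral_withDensity_eq_integral_toReal_smul hr.measurable.ennreal_ofReal
      (Filter.Eventually.of_forall fun σ => ENNReal.ofReal_lt_top)]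
    refine integral_congr_ae (Filter.Eventually.of_forall fun σ => ?_)
    simp [ENNReal.toReal_ofReal (hr0 σ)]
  have hint : ∀ (r : Config d → ℝ), Continuous r →
      IsFiniteMeasure (μ.withDensity fun σ => ENNReal.ofReal (r σ)) := fun r hr =>
    isFiniteMeasure_withDensity_ofReal (integrable_of_continuous hr).2
  have := hint _ hc
  have := hint _ hcf
  rw [integral_add i1 i2]
  conv_lhs => rw [hμ.measure_eq x]
  rw [integral_add_measure, integral_map hfl.aemeasurable hF.aestronglyMeasurable]
  · congr 1
    · exact hwd _ hcf (fun σ => rate_nonneg β ω x _) F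
    · exact hwd _ hc (fun σ => rate_nonneg β ω x _) fun σ => F (flip σ x)
  · exact integrable_of_continuous hF
  · exact integrable_of_continuous hF

/-- Detailed balance. -/
theorem IsGibbs.integral_rate_mul_flip (hμ : IsGibbs β ω μ) (x : Site d) {F : Config d → ℂ}
    (hF : Continuous F) :
    ∫ σ, (rate β ω x σ : ℂ) * F (flip σ x) ∂μ = ∫ σ, (rate β ω x σ : ℂ) * F σ ∂μ := by
  have hc := Complex.continuous_ofReal.comp (continuous_rate β ω x)
  -- Resampling the spin at `x` turns both integrands into `w_x(σ) w_x(σ^x) (F(σ) + F(σ^x))`.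
  rw [hμ.integral_eq x (F := fun σ => (rate β ω x σ : ℂ) * F (flip σ x))
      (hc.mul (hF.comp (continuous_flip x))),
    hμ.integral_eq x (F := fun σ => (rate β ω x σ : ℂ) * F σ) (hc.mul hF)]
  refine integral_congr_ae (Filter.Eventually.of_forall fun σ => ?_)
  simp only [flip_flip]
  ring

theorem IsGibbs.isSymmRel_coreGraph (hμ : IsGibbs β ω μ) : IsSymmRel (coreGraph β ω μ) := by
  have := hμ.isProbabilityMeasure
  rintro p ⟨f, hf, hp1, hp2⟩ q ⟨g, hg, hq1, hq2⟩
  obtain ⟨Λ, hfΛ, hgΛ⟩ := hf.exists_common hg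
  rw [L2.inner_def, L2.inner_def]
  have h1 : ∫ a, ⟪p.1 a, q.2 a⟫_ℂ ∂μ = ∫ σ, ∑ x ∈ Λ,
      (rate β ω x σ : ℂ) * ((g σ - g (flip σ x)) * star (f σ)) ∂μ := by
    refine integral_congr_ae ?_
    filter_upwards [hp1, hq2] with σ h1 h2
    rw [h1, h2, glauber_eq_sum β ω hgΛ, RCLike.inner_apply, Finset.sum_mul]
    exact Finset.sum_congr rfl fun x _ => by rw [mul_assoc]; rfl
  have h2 : ∫ a, ⟪p.2 a, q.1 a⟫_ℂ ∂μ = ∫ σ, ∑ x ∈ Λ,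
      (rate β ω x σ : ℂ) * (g σ * star (f σ - f (flip σ x))) ∂μ := by
    refine integral_congr_ae ?_
    filter_upwards [hp2, hq1] with σ h1 h2
    rw [h1, h2, glauber_eq_sum β ω hfΛ, RCLike.inner_apply, map_sum, Finset.mul_sum]
    refine Finset.sum_congr rfl fun x _ => ?_
    rw [map_mul, Complex.conj_ofReal]
    simp only [starRingEnd_apply]
    ring
  have hcf := hf.continuous
  have hcg := hg.continuous
  have hcr := fun x => Complex.continuous_ofReal.comp (continuous_rate β ω x)
  have hcff := fun x => hcf.comp (continuous_flip x)
  have hcgf := fun x => hcg.comp (continuous_flip x)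
  rw [h1, h2, integral_finsetSum, integral_finsetSum]
  · refine Finset.sum_congr rfl fun x _ => ?_
    -- Only the cross terms differ between the two sides; detailed balance for this `F` exchanges
    -- them.
    have hdb := hμ.integral_rate_mul_flip x (F := fun σ => g σ * star (f (flip σ x)))
      (hcg.mul (hcff x).star)
    simp only [flip_flip] at hdb
    simp only [sub_mul, mul_sub, star_sub]
    rw [integral_sub, integral_sub, hdb]
    all_goals refine integrable_of_continuous ((hcr x).mul ?_)
    · exact hcg.mul hcf.star
    · exact hcg.mul (hcff x).star
    · exact hcg.mul hcf.star
    · exact (hcgf x).mul hcf.star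
  · exact fun x _ => integrable_of_continuous
      ((hcr x).mul (hcg.mul (hcf.sub (hcff x)).star))
  · exact fun x _ => integrable_of_continuous
      ((hcr x).mul ((hcg.sub (hcgf x)).mul hcf.star))

variable [IsProbabilityMeasure μ]

/-- The class in `L²(μ)` of a continuous function. -/
def toL2 (μ : Measure (Config d)) [IsProbabilityMeasure μ] : C(Config d, ℂ) →L[ℂ] Lp ℂ 2 μ :=
  ContinuousMap.toLp 2 μ ℂ

theorem dense_toL2_cylinder :
    Dense (toL2 μ '' {f : C(Config d, ℂ) | IsCylinder (f : Config d → ℂ)}) := by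
  have : DenseRange (toL2 μ) := ContinuousMap.toLp_denseRange ℂ μ ℂ (by simp)
  exact this.dense_image (toL2 μ).continuous dense_isCylinder

theorem dense_coreGraph_fst :
    Dense ((coreGraph β ω μ).map (LinearMap.fst ℂ (Lp ℂ 2 μ) (Lp ℂ 2 μ)) : Set (Lp ℂ 2 μ)) := by
  refine (dense_toL2_cylinder (μ := μ)).mono ?_
  rintro _ ⟨f, hf, rfl⟩
  exact ⟨(toL2 μ f, toL2 μ ⟨glauber β ω f, IsCylinder.continuous_glauber β ω hf⟩),
    ⟨f, hf, ContinuousMap.coeFn_toLp μ f, ContinuousMap.coeFn_toLp μ _⟩, rfl⟩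

/-- The embedding of the Walsh space into `L²(μ)`. -/
def walshL2 (μ : Measure (Config d)) [IsProbabilityMeasure μ] : WalshSpace d →L[ℂ] Lp ℂ 2 μ :=
  toL2 μ ∘L walshSum

theorem coeFn_walshL2 (f : WalshSpace d) : walshL2 μ f =ᵐ[μ] walshSum f :=
  ContinuousMap.coeFn_toLp μ _

theorem denseRange_walshL2 : DenseRange (walshL2 μ) := by
  refine (dense_toL2_cylinder (μ := μ)).mono ?_
  rintro _ ⟨f, ⟨Λ, hf⟩, rfl⟩
  obtain ⟨k, -, hk⟩ := exists_walshSum_eq hf fun σ => f.norm_coe_le_norm σ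
  exact ⟨k, congrArg (toL2 μ) (ContinuousMap.ext hk)⟩

theorem norm_walshL2_unitVec (A : Finset (Site d)) : ‖walshL2 μ (unitVec A)‖ = 1 := by
  have h : eLpNorm (walshL2 μ (unitVec A)) 2 μ = 1 := by
    rw [eLpNorm_congr_norm_ae (g := fun _ => (1 : ℝ)), eLpNorm_const _ (by simp)
      (IsProbabilityMeasure.ne_zero μ)]
    · simp
    · filter_upwards [coeFn_walshL2 (unitVec A)] with σ hσ
      rw [hσ, walshSum_unitVec, norm_walsh_apply, norm_one]
  rw [Lp.norm_def, h, ENNReal.toReal_one]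

theorem IsGibbs.graph_generator (hμ : IsGibbs β ω μ) :
    (generator β ω μ).graph = (coreGraph β ω μ).topologicalClosure :=
  graph_closure_toLinearPMap hμ.isSymmRel_coreGraph dense_coreGraph_fst

theorem IsGibbs.isSymmRel_graph (hμ : IsGibbs β ω μ) : IsSymmRel (generator β ω μ).graph := by
  rw [hμ.graph_generator]
  exact hμ.isSymmRel_coreGraph.topologicalClosure

theorem IsGibbs.isClosed_graph (hμ : IsGibbs β ω μ) :
    IsClosed ((generator β ω μ).graph : Set (Lp ℂ 2 μ × Lp ℂ 2 μ)) := by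
  rw [hμ.graph_generator]
  exact Submodule.isClosed_topologicalClosure _

end GibbsStates

/-! ### Walsh coefficients of `tanh` of the local field at small `β`. -/

section HighTemperature

variable {d : ℕ} {Jm Jp : ℝ} {β : ℝ} {ω : Realization d Jm Jp}

theorem abs_tanh_sub_self_le {h : ℝ} (hh : |h| ≤ 1 / 2) : |Real.tanh h - h| ≤ 8 * h ^ 2 := by
  have h1 : |2 * h| ≤ 1 := by
    rw [abs_mul, abs_two]
    linarith
  have hr := Real.abs_exp_sub_one_sub_id_le h1
  set r := Real.exp (2 * h) - 1 - 2 * h with hrdef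
  have hpos := Real.exp_pos (2 * h)
  have htanh : Real.tanh h = (Real.exp (2 * h) - 1) / (Real.exp (2 * h) + 1) := by
    have h2 : Real.exp (2 * h) = Real.exp h * Real.exp h := by
      rw [← Real.exp_add]; congr 1; ring
    have hmul : Real.exp h * Real.exp (-h) = 1 := by rw [← Real.exp_add]; simp
    rw [Real.tanh_eq_sinh_div_cosh, Real.sinh_eq, Real.cosh_eq, h2]
    have hp := Real.exp_pos h
    have hm := Real.exp_pos (-h)
    field_simp
    linear_combination (-2 * Real.exp h) * hmul
  have hdiff : Real.tanh h - h = (r * (1 - h) - 2 * h ^ 2) / (Real.exp (2 * h) + 1) := by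
    rw [htanh, hrdef]
    field_simp
    ring
  rw [hdiff, abs_div, abs_of_pos (by positivity : 0 < Real.exp (2 * h) + 1),
    div_le_iff₀ (by positivity)]
  obtain ⟨ha, hb⟩ := abs_le.1 hh
  -- The constant `8` is `6 + 2`: `6 h²` from this term and `2 h²` from the other; the denominator
  -- exceeds `1`.
  have h3 : |r * (1 - h)| ≤ (2 * h) ^ 2 * (3 / 2) := by
    rw [abs_mul]
    gcongr
    exact abs_le.2 ⟨by linarith, by linarith⟩
  have h4 : |r * (1 - h) - 2 * h ^ 2| ≤ 8 * h ^ 2 := by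
    refine (abs_sub _ _).trans ?_
    rw [abs_of_nonneg (by positivity : 0 ≤ 2 * h ^ 2)]
    linarith
  nlinarith [sq_nonneg h]

theorem abs_coupling_le (ω : Realization d Jm Jp) (x y : Site d) :
    |coupling ω x y| ≤ max |Jm| |Jp| := by
  unfold coupling
  split_ifs with h
  · exact abs_le_max_abs_abs (ω _).2.1 (ω _).2.2
  · simp

theorem sum_coupling_le {J : ℝ} (hJ : J = max |Jm| |Jp|) (ω : Realization d Jm Jp) (x : Site d) :
    ∑ y ∈ nbrs x, |coupling ω x y| ≤ 2 * d * J := by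
  have hJ0 : 0 ≤ J := hJ ▸ (abs_nonneg Jm).trans (le_max_left _ _)
  calc ∑ y ∈ nbrs x, |coupling ω x y| ≤ ∑ _y ∈ nbrs x, J :=
        Finset.sum_le_sum fun y _ => hJ ▸ abs_coupling_le ω x y
    _ = (nbrs x).card * J := by rw [Finset.sum_const, nsmul_eq_mul]
    _ ≤ 2 * d * J := by
        gcongr
        exact_mod_cast card_nbrs_le x

theorem abs_localField_le {J : ℝ} (hJ : J = max |Jm| |Jp|) (hβ : 0 ≤ β)
    (ω : Realization d Jm Jp) (x : Site d) (σ : Config d) :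
    |localField β ω x σ| ≤ 2 * d * J * β := by
  unfold localField
  rw [abs_mul, abs_of_nonneg hβ, mul_comm]
  gcongr
  refine (Finset.abs_sum_le_sum_abs _ _).trans (le_trans (le_of_eq ?_) (sum_coupling_le hJ ω x))
  exact Finset.sum_congr rfl fun y _ => by rw [abs_mul, abs_spin, mul_one]

/-- The bound on the width of the one particle branch. -/
def branchWidth (d : ℕ) (J β : ℝ) : ℝ :=
  2 * d * J * β + 2 ^ (2 * d) * (8 * (2 * d * J) ^ 2) * β ^ 2

/-- The local field is a combination of single spins with `ℓ¹` norm at most `2dJβ`. Only `tanh h - h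
= O(β²)` goes through the general expansion and pays `2 ^ (2 * d)`, so the first-order coefficient
is not spoiled. -/
theorem exists_walshSum_eq_tanh {J : ℝ} (hJ : J = max |Jm| |Jp|) (hβ : 0 ≤ β)
    (hsmall : 2 * d * J * β ≤ 1 / 2) (ω : Realization d Jm Jp) (x : Site d) :
    ∃ k : WalshSpace d, ‖k‖ ≤ branchWidth d J β ∧
      ∀ σ, walshSum k σ = (Real.tanh (localField β ω x σ) : ℂ) := by
  have hdep : DependsOn (fun σ => ((Real.tanh (localField β ω x σ) - localField β ω x σ : ℝ) : ℂ))
      (nbrs x : Set (Site d)) := fun σ τ h => by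
    simp only [dependsOn_localField β ω x h]
  have hb : ∀ σ, ‖((Real.tanh (localField β ω x σ) - localField β ω x σ : ℝ) : ℂ)‖
      ≤ 8 * (2 * d * J * β) ^ 2 := fun σ => by
    have h := abs_localField_le hJ hβ ω x σ
    rw [Complex.norm_real, Real.norm_eq_abs]
    refine (abs_tanh_sub_self_le (h.trans hsmall)).trans ?_
    rw [← sq_abs]
    gcongr
  obtain ⟨k, hk, hk'⟩ := exists_walshSum_eq hdep hb
  refine ⟨(∑ y ∈ nbrs x, ((β * coupling ω x y : ℝ) : ℂ) • unitVec {y}) + k, ?_, fun σ => ?_⟩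
  · have h1 : ‖∑ y ∈ nbrs x, ((β * coupling ω x y : ℝ) : ℂ) • (unitVec {y} : WalshSpace d)‖
        ≤ 2 * d * J * β := by
      refine (norm_sum_le _ _).trans ?_
      have h2 : ∀ y ∈ nbrs x, ‖((β * coupling ω x y : ℝ) : ℂ) • (unitVec {y} : WalshSpace d)‖
          = |coupling ω x y| * β := fun y _ => by
        rw [norm_smul, norm_unitVec, mul_one, Complex.norm_real, Real.norm_eq_abs, abs_mul,
          abs_of_nonneg hβ, mul_comm]
      rw [Finset.sum_congr rfl h2, ← Finset.sum_mul]
      gcongr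
      exact sum_coupling_le hJ ω x
    have h3 : ‖k‖ ≤ 2 ^ (2 * d) * (8 * (2 * d * J * β) ^ 2) := by
      refine hk.trans ?_
      gcongr
      · exact one_le_two
      · exact card_nbrs_le x
    refine (norm_add_le _ _).trans ((add_le_add h1 h3).trans (le_of_eq ?_))
    unfold branchWidth
    ring
  · rw [map_add, map_sum, ContinuousMap.add_apply, hk', ContinuousMap.sum_apply]
    have h4 : ∀ y ∈ nbrs x, walshSum (((β * coupling ω x y : ℝ) : ℂ) • unitVec {y}) σ
        = ((β * (coupling ω x y * spin σ y) : ℝ) : ℂ) := fun y _ => by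
      rw [map_smul, walshSum_unitVec, ContinuousMap.smul_apply, walsh_apply,
        Finset.prod_singleton]
      push_cast
      simp [mul_assoc]
    rw [Finset.sum_congr rfl h4, ← Complex.ofReal_sum, ← Finset.mul_sum, ← Complex.ofReal_add]
    unfold localField
    ring_nf

end HighTemperature

/-! ### Inverting `z - L` on Walsh coefficients; kernel and one particle branch. -/

section Perturbation

variable {d : ℕ} {Jm Jp : ℝ} {β : ℝ} {ω : Realization d Jm Jp} {μ : Measure (Config d)}
  [IsProbabilityMeasure μ]

open Classical in
/-- The off-diagonal part of the generator, applied to `σ_A`, where `k x` are the Walsh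
coefficients of the hyperbolic tangent of the local field at `x`. -/
def interaction (k : Site d → WalshSpace d) (A : Finset (Site d)) : WalshSpace d :=
  ∑ x ∈ A, walshShift (A.erase x) (k x)

theorem norm_interaction_le {k : Site d → WalshSpace d} {κ : ℝ} (hk : ∀ x, ‖k x‖ ≤ κ)
    (A : Finset (Site d)) : ‖interaction k A‖ ≤ A.card * κ := by
  classical
  refine (norm_sum_le _ _).trans ?_
  rw [← nsmul_eq_mul, ← Finset.sum_const]
  exact Finset.sum_le_sum fun x _ => (norm_walshShift_apply_le _ _).trans (hk x)

theorem walshL2_mem_coreGraph {k : Site d → WalshSpace d}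
    (hk : ∀ x σ, walshSum (k x) σ = (Real.tanh (localField β ω x σ) : ℂ))
    (A : Finset (Site d)) :
    (walshL2 μ (unitVec A), walshL2 μ ((A.card : ℂ) • unitVec A - interaction k A))
      ∈ coreGraph β ω μ := by
  classical
  refine ⟨walsh A, ⟨A, dependsOn_walsh A⟩, ?_, ?_⟩
  · rw [← walshSum_unitVec]
    exact coeFn_walshL2 _
  · refine (coeFn_walshL2 _).trans (Filter.Eventually.of_forall fun σ => ?_)
    rw [glauber_walsh, map_sub, map_smul, walshSum_unitVec, interaction, map_sum,
      ContinuousMap.sub_apply, ContinuousMap.sum_apply, ContinuousMap.smul_apply, smul_eq_mul]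
    congr 1
    exact Finset.sum_congr rfl fun x _ => by rw [walshSum_walshShift, hk, mul_comm]

theorem IsGibbs.walshL2_mem_graph (hμ : IsGibbs β ω μ) {k : Site d → WalshSpace d}
    (hk : ∀ x σ, walshSum (k x) σ = (Real.tanh (localField β ω x σ) : ℂ))
    (A : Finset (Site d)) :
    (walshL2 μ (unitVec A), walshL2 μ ((A.card : ℂ) • unitVec A - interaction k A))
      ∈ (generator β ω μ).graph := by
  rw [hμ.graph_generator]
  exact Submodule.le_topologicalClosure _ (walshL2_mem_coreGraph hk A)

theorem isUnit_one_add {B : WalshSpace d →L[ℂ] WalshSpace d} (hB : ‖B‖ < 1) :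
    IsUnit (1 + B) := by
  have := isUnit_one_sub_of_norm_lt_one (x := -B) (by rwa [norm_neg])
  rwa [sub_neg_eq_add] at this

/-- A real number is in the resolvent set if the interaction is small relative to its distance
from the particle numbers. -/
theorem IsGibbs.mem_resolventSet (hμ : IsGibbs β ω μ) {k : Site d → WalshSpace d} {κ : ℝ}
    (hκ : ∀ x, ‖k x‖ ≤ κ)
    (hk : ∀ x σ, walshSum (k x) σ = (Real.tanh (localField β ω x σ) : ℂ))
    {z q C : ℝ} (hq0 : 0 ≤ q) (hq1 : q < 1) (hz : ∀ n : ℕ, z ≠ n) (hC : ∀ n : ℕ, |z - n|⁻¹ ≤ C)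
    (hq : ∀ n : ℕ, n * κ ≤ q * |z - n|) : (z : ℂ) ∈ resolventSet (generator β ω μ) := by
  have hnorm : ∀ n : ℕ, ‖((z : ℂ) - n)⁻¹‖ = |z - n|⁻¹ := fun n => by
    rw [norm_inv, ← Complex.ofReal_natCast, ← Complex.ofReal_sub, Complex.norm_real,
      Real.norm_eq_abs]
  have hpos : ∀ n : ℕ, 0 < |z - n| := fun n => abs_pos.2 (sub_ne_zero.2 (hz n))
  have hD : ∀ A : Finset (Site d),
      ‖((z : ℂ) - A.card)⁻¹ • (unitVec A : WalshSpace d)‖ ≤ C := fun A => by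
    rw [norm_smul, norm_unitVec, mul_one, hnorm]
    exact hC _
  have hB : ∀ A : Finset (Site d), ‖((z : ℂ) - A.card)⁻¹ • interaction k A‖ ≤ q := fun A => by
    rw [norm_smul, hnorm, inv_mul_le_iff₀ (hpos _), mul_comm]
    exact (norm_interaction_le hκ A).trans (hq _)
  -- With `N` the number operator and `K` the interaction, `D = (z - N)⁻¹` and `B = K (z - N)⁻¹`.
  -- Since `L = N - K`, formally `(z - L) D = 1 + B`, and the inverse of `z - L` is `D (1 + B)⁻¹`.
  set D : WalshSpace d →L[ℂ] WalshSpace d := ellOneLift _ C hD with hDdef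
  set B : WalshSpace d →L[ℂ] WalshSpace d := ellOneLift _ q hB with hBdef
  obtain ⟨U, hU⟩ := isUnit_one_add ((norm_ellOneLift_le hq0 hB).trans_lt hq1)
  have hgraph : ∀ f, (walshL2 μ (D f), (z : ℂ) • walshL2 μ (D f) - walshL2 μ (f + B f))
      ∈ (generator β ω μ).graph := by
    intro f
    let Φ : WalshSpace d →L[ℂ] Lp ℂ 2 μ × Lp ℂ 2 μ :=
      (walshL2 μ ∘L D).prod ((z : ℂ) • (walshL2 μ ∘L D) - walshL2 μ ∘L (1 + B))
    -- The graph is closed, so the relation needs checking only on the basis vectors.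
    have hmem : f ∈ (generator β ω μ).graph.comap (Φ : WalshSpace d →ₗ[ℂ] _) := by
      refine ellOne_mem_of_unitVec (hμ.isClosed_graph.preimage Φ.continuous) (fun A => ?_) f
      have hA := (generator β ω μ).graph.smul_mem (((z : ℂ) - A.card)⁻¹)
        (hμ.walshL2_mem_graph hk A)
      change (walshL2 μ (D (unitVec A)),
        (z : ℂ) • walshL2 μ (D (unitVec A)) - walshL2 μ (unitVec A + B (unitVec A)))
          ∈ (generator β ω μ).graph
      convert hA using 1
      rw [hDdef, hBdef, ellOneLift_unitVec, ellOneLift_unitVec, Prod.smul_mk]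
      simp only [map_smul, map_add, map_sub]
      congr 1
      have hne : (z : ℂ) - A.card ≠ 0 := by
        rw [sub_ne_zero]
        exact_mod_cast hz A.card
      have h1 : (z : ℂ) * ((z : ℂ) - A.card)⁻¹ = 1 + ((z : ℂ) - A.card)⁻¹ * A.card := by
        field_simp
        ring
      rw [smul_smul, h1, smul_sub, smul_smul, add_smul, one_smul]
      abel
    exact hmem
  refine mem_resolventSet_of_symmetrizable hμ.isSymmRel_graph hμ.isClosed_graph (walshL2 μ)
    denseRange_walshL2 z (D * ((U⁻¹ : (WalshSpace d →L[ℂ] WalshSpace d)ˣ) :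
      WalshSpace d →L[ℂ] WalshSpace d)) fun f => ?_
  set V : WalshSpace d →L[ℂ] WalshSpace d :=
    ((U⁻¹ : (WalshSpace d →L[ℂ] WalshSpace d)ˣ) : WalshSpace d →L[ℂ] WalshSpace d) with hV
  have hf : V f + B (V f) = f := by
    have h : (U : WalshSpace d →L[ℂ] WalshSpace d) * V = 1 := U.mul_inv
    rw [hU] at h
    simpa using DFunLike.congr_fun h f
  have := hgraph (V f)
  rw [hf] at this
  exact this

/-- The real numbers below `3/2` in the resolvent set. -/
theorem IsGibbs.mem_resolventSet_of_lt (hμ : IsGibbs β ω μ) {k : Site d → WalshSpace d} {κ : ℝ}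
    (hκ : ∀ x, ‖k x‖ ≤ κ)
    (hk : ∀ x σ, walshSum (k x) σ = (Real.tanh (localField β ω x σ) : ℂ))
    (hκ0 : 0 ≤ κ) (hκ1 : κ < 1 / 4) {z : ℝ} (hz : z < 3 / 2) (hz0 : z ≠ 0)
    (hz1 : κ < |z - 1|) : (z : ℂ) ∈ resolventSet (generator β ω μ) := by
  have hz1pos : 0 < |z - 1| := hκ0.trans_lt hz1
  -- For `z < 3/2` and `n ≥ 2`, `4 (n - z) > 4 n - 6 ≥ n`. Hence the ratio `n κ / |z - n|` is at
  -- most `4 κ` there, is `κ / |z - 1|` at `n = 1`, and vanishes at `n = 0`.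
  have hbig : ∀ n : ℕ, 2 ≤ n → (n : ℝ) ≤ 4 * |z - n| ∧ 1 / 2 ≤ |z - n| := fun n hn => by
    have hn' : (2 : ℝ) ≤ n := by exact_mod_cast hn
    rw [abs_sub_comm, abs_of_pos (by linarith)]
    constructor <;> linarith
  refine hμ.mem_resolventSet hκ hk (q := max (κ / |z - 1|) (4 * κ))
    (C := |z|⁻¹ + |z - 1|⁻¹ + 2) (le_max_of_le_right (by linarith))
    (max_lt ((div_lt_one hz1pos).2 hz1) (by linarith)) ?_ ?_ ?_
  · intro n hn
    rcases n with _ | _ | n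
    · exact hz0 (by simpa using hn)
    · rw [hn] at hz1pos
      simp at hz1pos
    · have := (hbig (n + 1 + 1) (by omega)).2
      rw [← hn, sub_self, abs_zero] at this
      linarith
  · intro n
    rcases n with _ | _ | n
    · simp only [Nat.cast_zero, sub_zero]
      have : 0 ≤ |z - 1|⁻¹ := by positivity
      linarith
    · simp only [zero_add, Nat.cast_one]
      have : 0 ≤ |z|⁻¹ := by positivity
      linarith
    · have h := (hbig (n + 1 + 1) (by omega)).2
      have h2 : |z - ((n + 1 + 1 : ℕ) : ℝ)|⁻¹ ≤ 2 := by
        rw [inv_le_comm₀ (by linarith) two_pos]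
        linarith
      have h3 : 0 ≤ |z|⁻¹ := by positivity
      have h4 : 0 ≤ |z - 1|⁻¹ := by positivity
      linarith
  · intro n
    rcases n with _ | _ | n
    · simp only [Nat.cast_zero, zero_mul]
      positivity
    · simp only [zero_add, Nat.cast_one, one_mul]
      rw [← div_le_iff₀ hz1pos]
      exact le_max_left _ _
    · have h := (hbig (n + 1 + 1) (by omega)).1
      calc ((n + 1 + 1 : ℕ) : ℝ) * κ ≤ 4 * |z - ((n + 1 + 1 : ℕ) : ℝ)| * κ := by gcongr
        _ = 4 * κ * |z - ((n + 1 + 1 : ℕ) : ℝ)| := by ring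
        _ ≤ _ := by
          gcongr
          exact le_max_right _ _

/-- The kernel of the generator consists of the constants. -/
theorem IsGibbs.eq_const_of_generator_eq_zero (hμ : IsGibbs β ω μ) {k : Site d → WalshSpace d}
    {κ : ℝ} (hκ : ∀ x, ‖k x‖ ≤ κ)
    (hk : ∀ x σ, walshSum (k x) σ = (Real.tanh (localField β ω x σ) : ℂ))
    (hκ0 : 0 ≤ κ) (hκ1 : κ < 1) (u : (generator β ω μ).domain) (hu : generator β ω μ u = 0) :
    ∃ c : ℂ, (u : Lp ℂ 2 μ) =ᵐ[μ] fun _ => c := by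
  have hempty : interaction k (∅ : Finset (Site d)) = 0 := by simp [interaction]
  have hv0 : (walshL2 μ (unitVec ∅), 0) ∈ (generator β ω μ).graph := by
    simpa [hempty] using hμ.walshL2_mem_graph hk ∅
  -- Here `1 + B` sends `σ_A` to `L σ_A / |A|` for nonempty `A` and fixes the constant `σ_∅` (where
  -- `0⁻¹ = 0`). Its surjectivity makes the range of `L` plus the constants dense.
  have hB : ∀ A : Finset (Site d), ‖-((A.card : ℂ)⁻¹ • interaction k A)‖ ≤ κ := fun A => by
    rw [norm_neg, norm_smul, norm_inv, Complex.norm_natCast]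
    rcases A.eq_empty_or_nonempty with rfl | hA
    · simpa using hκ0
    · rw [inv_mul_le_iff₀ (by exact_mod_cast hA.card_pos)]
      exact norm_interaction_le hκ A
  set B : WalshSpace d →L[ℂ] WalshSpace d := ellOneLift _ κ hB with hBdef
  obtain ⟨U, hU⟩ := isUnit_one_add ((norm_ellOneLift_le hκ0 hB).trans_lt hκ1)
  have hdense : ∀ w : Lp ℂ 2 μ, (∀ p ∈ (generator β ω μ).graph, ⟪w, p.2⟫_ℂ = 0) →
      ⟪w, walshL2 μ (unitVec ∅)⟫_ℂ = 0 → w = 0 := by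
    intro w hw hwv
    let Φ : WalshSpace d →L[ℂ] ℂ := innerSL ℂ w ∘L walshL2 μ ∘L (1 + B)
    have hΦ : ∀ f, f ∈ LinearMap.ker (Φ : WalshSpace d →ₗ[ℂ] ℂ) := by
      refine ellOne_mem_of_unitVec Φ.isClosed_ker fun A => ?_
      change ⟪w, walshL2 μ (unitVec A + B (unitVec A))⟫_ℂ = 0
      rw [hBdef, ellOneLift_unitVec]
      rcases A.eq_empty_or_nonempty with rfl | hA
      · simpa [hempty] using hwv
      · have hne : (A.card : ℂ) ≠ 0 := by exact_mod_cast hA.card_pos.ne'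
        have h1 := hw _ (hμ.walshL2_mem_graph hk A)
        have h2 : unitVec A + -((A.card : ℂ)⁻¹ • interaction k A)
            = (A.card : ℂ)⁻¹ • ((A.card : ℂ) • unitVec A - interaction k A) := by
          rw [smul_sub, smul_smul, inv_mul_cancel₀ hne, one_smul, sub_eq_add_neg]
        rw [h2, map_smul, inner_smul_right, h1, mul_zero]
    refine Dense.eq_zero_of_inner_left (𝕜 := ℂ) (denseRange_walshL2 (μ := μ)) ?_
    rintro _ ⟨f, rfl⟩
    have hf : (1 + B) ((↑U⁻¹ : WalshSpace d →L[ℂ] WalshSpace d) f) = f := by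
      rw [← hU]
      exact DFunLike.congr_fun U.mul_inv f
    have := hΦ ((↑U⁻¹ : WalshSpace d →L[ℂ] WalshSpace d) f)
    change ⟪w, walshL2 μ ((1 + B) ((↑U⁻¹ : WalshSpace d →L[ℂ] WalshSpace d) f))⟫_ℂ = 0 at this
    rwa [hf] at this
  obtain ⟨c, hc⟩ := mem_span_of_apply_eq_zero hμ.isSymmRel_graph (walshL2 μ (unitVec ∅))
    (norm_walshL2_unitVec _) hv0 hdense u hu
  refine ⟨c, ?_⟩
  rw [hc]
  filter_upwards [Lp.coeFn_smul c (walshL2 μ (unitVec ∅)), coeFn_walshL2 (μ := μ) (unitVec ∅)]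
    with σ h1 h2
  rw [h1, Pi.smul_apply, h2, walshSum_unitVec, walsh_apply, Finset.prod_empty, smul_eq_mul,
    mul_one]

theorem norm_walshL2_le (f : WalshSpace d) : ‖walshL2 μ f‖ ≤ ‖f‖ := by
  have h1 : ‖walshL2 μ f‖ ≤ ‖walshSum f‖ := by
    have h := Lp.norm_le_of_ae_bound (f := walshL2 μ f) (norm_nonneg (walshSum f)) (by
      filter_upwards [coeFn_walshL2 (μ := μ) f] with σ hσ
      rw [hσ]
      exact ContinuousMap.norm_coe_le_norm _ σ)
    simpa [measureUnivNNReal] using h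
  refine h1.trans ?_
  simpa using walshSum.le_of_opNorm_le (norm_ellOneLift_le zero_le_one norm_walsh_le) f

/-- A single spin is an approximate eigenvector with eigenvalue `1`. -/
theorem IsGibbs.oneParticleBranch_nonempty (hμ : IsGibbs β ω μ) {k : Site d → WalshSpace d}
    {κ : ℝ} (hκ : ∀ x, ‖k x‖ ≤ κ)
    (hk : ∀ x σ, walshSum (k x) σ = (Real.tanh (localField β ω x σ) : ℂ)) (hκ1 : κ < 1 / 2) :
    (oneParticleBranch β ω μ).Nonempty := by
  have hg := hμ.walshL2_mem_graph hk {0}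
  obtain ⟨u, hu1, hu2⟩ := (LinearPMap.mem_graph_iff _).1 hg
  have h : ‖((1 : ℝ) : ℂ) • (u : Lp ℂ 2 μ) - generator β ω μ u‖
      -- The defect of `σ_0` as an eigenvector for `1` is its interaction term, of norm at most `κ`,
      -- while `σ_0` has norm `1`.
      < 1 / 2 * ‖(u : Lp ℂ 2 μ)‖ := by
    rw [hu1, hu2, norm_walshL2_unitVec]
    simp only [Complex.ofReal_one, one_smul, Finset.card_singleton, Nat.cast_one, map_sub,
      sub_sub_cancel, mul_one]
    refine ((norm_walshL2_le _).trans (norm_interaction_le hκ _)).trans_lt ?_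
    simpa using hκ1
  have := opSpectrum_inter_ball_nonempty hμ.isSymmRel_graph (by norm_num) u h
  simpa [oneParticleBranch] using this

end Perturbation

end

end DisorderedIsing

/-! ### The spectral theorem for the generator. -/

open DisorderedIsing MeasureTheory in
theorem theorem2p1 (d : ℕ) (hd : 1 ≤ d) (J : ℝ) :
    ∃ βd : ℝ, 0 < βd ∧ ∃ gm gp : ℝ → ℝ,
      AnalyticOnNhd ℝ gm (Set.Ico 0 βd) ∧
      AnalyticOnNhd ℝ gp (Set.Ico 0 βd) ∧
      (fun β : ℝ => gm β - (1 - 2 * d * J * β)) =o[nhds 0] (fun β : ℝ => β) ∧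
      (fun β : ℝ => gp β - (1 + 2 * d * J * β)) =o[nhds 0] (fun β : ℝ => β) ∧
      ∀ Jm Jp : ℝ, J = max |Jm| |Jp| →
      ∀ β ∈ Set.Ico 0 βd, ∀ ω : Realization d Jm Jp,
      ∀ μ : Measure (Config d), IsGibbs β ω μ →
        -- the 1-particle branch lies in `[g⁻(β), g⁺(β)]`
        oneParticleBranch β ω μ ⊆ Complex.ofReal '' Set.Icc (gm β) (gp β) ∧
        -- it is the first non trivial branch: it is not empty, the eigenvalue `0` has only
        -- the constants as eigenfunctions, and the rest of the spectrum lies above `3/2`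
        (oneParticleBranch β ω μ).Nonempty ∧
        (∀ u : (generator β ω μ).domain, generator β ω μ u = 0 →
          ∃ c : ℂ, (u : Lp ℂ 2 μ) =ᵐ[μ] fun _ => c) ∧
        opSpectrum (generator β ω μ) ⊆
          {0} ∪ oneParticleBranch β ω μ ∪ Complex.ofReal '' Set.Ici (3 / 2) := by
  set a : ℝ := 2 * d * J with ha
  set C : ℝ := 2 ^ (2 * d) * (8 * a ^ 2) with hC
  have hC0 : 0 ≤ C := by positivity
  have ho : (fun β : ℝ => C * β ^ 2) =o[nhds 0] (fun β : ℝ => β) := by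
    have h : (fun β : ℝ => β ^ 2) =o[nhds 0] (fun β : ℝ => β) := by
      simpa using Asymptotics.isLittleO_pow_pow (𝕜 := ℝ) (one_lt_two)
    exact h.const_mul_left C
  have hwidth : ∀ β, branchWidth d J β = a * β + C * β ^ 2 := fun β => rfl
  have hm : 0 < |a| + C + 1 := by positivity
  -- This bound gives `β ≤ 1`, hence `a β + C β² ≤ (a + C) β < 1/8`, within the required `κ < 1/4`.
  -- The absolute value serves `J < 0`, where the final claim is vacuous.
  refine ⟨1 / (8 * (|a| + C + 1)), by positivity, fun β => 1 - branchWidth d J β,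
    fun β => 1 + branchWidth d J β, ?_, ?_, ?_, ?_, ?_⟩
  · intro β _
    unfold branchWidth
    fun_prop
  · intro β _
    unfold branchWidth
    fun_prop
  · refine ho.neg_left.congr_left fun β => ?_
    simp only [hwidth]
    ring
  · refine ho.congr_left fun β => ?_
    simp only [hwidth]
    ring
  intro Jm Jp hJ β hβ ω μ hμ
  have hprob := hμ.isProbabilityMeasure
  obtain ⟨hβ0, hβ1⟩ := hβ
  rw [lt_div_iff₀ (by positivity)] at hβ1
  have hJ0 : 0 ≤ J := hJ ▸ (abs_nonneg Jm).trans (le_max_left _ _)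
  have ha0 : 0 ≤ a := by positivity
  rw [abs_of_nonneg ha0] at hβ1
  have haβ : 0 ≤ a * β := by positivity
  have hCβ : 0 ≤ C * β := by positivity
  have hβ8 : β ≤ 1 := by nlinarith
  have hCβ2 : C * β ^ 2 ≤ C * β := by nlinarith
  have hsmall : a * β ≤ 1 / 2 := by nlinarith
  have hκ1 : branchWidth d J β < 1 / 4 := by
    rw [hwidth]
    nlinarith
  have hκ0 : 0 ≤ branchWidth d J β := by
    rw [hwidth]
    positivity
  choose k hκ hk using fun x => exists_walshSum_eq_tanh hJ hβ0 hsmall ω x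
  have hres : ∀ z : ℝ, z < 3 / 2 → z ≠ 0 → branchWidth d J β < |z - 1| →
      (z : ℂ) ∈ DisorderedIsing.resolventSet (generator β ω μ) := fun z h1 h2 h3 =>
    hμ.mem_resolventSet_of_lt hκ hk hκ0 hκ1 h1 h2 h3
  have hreal : ∀ w ∈ opSpectrum (generator β ω μ), w = (w.re : ℂ) := fun w hw =>
    -- The point `1/2` lies in the gap between `0` and the branch, as `κ < 1/4`.
    opSpectrum_real hμ.isSymmRel_graph (z := 1 / 2)
      (hres _ (by norm_num) (by norm_num) (hκ1.trans (by norm_num [abs_of_neg]))) hw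
  have hspec : ∀ w ∈ opSpectrum (generator β ω μ), w.re < 3 / 2 → w.re ≠ 0 →
      |w.re - 1| ≤ branchWidth d J β := by
    intro w hw h1 h2
    by_contra! h3
    refine hw ?_
    rw [hreal w hw]
    exact hres _ h1 h2 h3
  refine ⟨?_, hμ.oneParticleBranch_nonempty hκ hk (by linarith),
    fun u hu => hμ.eq_const_of_generator_eq_zero hκ hk hκ0 (by linarith) u hu, ?_⟩
  · rintro w ⟨hw, hball⟩
    have hball' : |w.re - 1| < 1 / 2 := by
      rw [Metric.mem_ball, dist_eq_norm] at hball
      exact (by simpa using Complex.abs_re_le_norm (w - 1) : |w.re - 1| ≤ ‖w - 1‖).trans_lt hball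
    obtain ⟨h1, h2⟩ := abs_lt.1 hball'
    obtain ⟨h3, h4⟩ := abs_le.1 (hspec w hw (by linarith) (by linarith))
    exact ⟨w.re, ⟨by linarith, by linarith⟩, (hreal w hw).symm⟩
  · intro w hw
    by_cases h1 : 3 / 2 ≤ w.re
    · exact Or.inr ⟨w.re, h1, (hreal w hw).symm⟩
    by_cases h2 : w.re = 0
    · refine Or.inl (Or.inl ?_)
      rw [Set.mem_singleton_iff, hreal w hw, h2, Complex.ofReal_zero]
    refine Or.inl (Or.inr ⟨hw, ?_⟩)
    have h3 := hspec w hw (not_le.1 h1) h2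
    rw [hreal w hw, Metric.mem_ball, dist_eq_norm, ← Complex.ofReal_one, ← Complex.ofReal_sub,
      Complex.norm_real, Real.norm_eq_abs]
    linarith
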